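/- For $r\ge 2$ the hexagonal mesh $HX(r)$ is the graph whose vertices are the points of the triangular lattice at lattice distance at most $r-1$ from a fixed lattice point, two of them being adjacent when they are nearest neighbours (so $HX(2)$ consists of six triangles around a vertex). The third type of hex derived network $HDN3(r)$ is obtained from $HX(r)$ by replacing every triangle $K_3$ by a planar octahedron: the edges of the mesh stay, and each triangle $abc$ receives three new, pairwise adjacent vertices, one adjacent to $a,b$, one to $b,c$ and one to $a,c$. For a vertex $u$ of a graph $G$ let $S_u$ be the sum of the degrees of the neighbours of $u$, and put $$ABC_4(G)=\sum_{uv\in E(G)}\sqrt{\frac{S_u+S_v-2}{S_uS_v}},\qquad GA_5(G)=\sum_{uv\in E(G)}\frac{2\sqrt{S_uS_v}}{S_u+S_v}.$$ **Theorem.** Let $r\ge 5$ and $G=HDN3(r)$. The edges $uv$ of $G$ are partitioned according to $\{S_u,S_v\}$ into the following 32 classes (no other pair occurs): | $(S_u,S_v)$ | number of edges | $(S_u,S_v)$ | number of edges | |---|---|---|---| | $(25,33)$ | $12$ | $(44,44)$ | $18r^2-72r+72$ | | $(25,36)$ | $12$ | $(44,129)$ | $36$ | | $(25,54)$ | $12$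 | $(44,140)$ | $48r-144$ | | $(25,77)$ | $12$ | $(44,156)$ | $36r^2-180r+228$ | | $(28,36)$ | $12r-36$ | $(54,77)$ | $12$ | | $(28,77)$ | $12$ | $(54,129)$ | $6$ | | $(28,80)$ | $12r-48$ | $(77,80)$ | $12$ | | $(33,36)$ | $12$ | $(77,129)$ | $12$ | | $(33,54)$ | $12$ | $(77,140)$ | $12$ | | $(33,129)$ | $12$ | $(80,80)$ | $6r-30$ | | $(36,36)$ | $12r-30$ | $(80,140)$ | $12r-48$ | | $(36,44)$ | $12r-24$ | $(129,140)$ | $12$ | | $(36,77)$ | $48$ | $(129,156)$ | $6$ | | $(36,80)$ | $24r-96$ | $(140,140)$ | $6r-24$ | | $(36,129)$ | $24$ | $(140,156)$ | $12r-36$ | | $(36,140)$ | $24r-72$ | $(156,156)$ | $9r^2-51r+72$ | Moreover there are real constants $c_A$ and $c_G$, independent of $r$, equal to $53.139$ and $315.338$ respectively up to an error of at most $0.0005$, such that for every $r\ge5$ $$\begin{aligned}ABC_4(G)={}&c_A+\tfrac{3}{20}\sqrt{\tfrac{79}{2}}(r-5)+3\sqrt{\tfrac{53}{70}}(r-4)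+\tfrac35\sqrt{\tfrac{109}{14}}(r-4)+\sqrt{\tfrac{114}{5}}(r-4)+\tfrac{3}{35}\sqrt{\tfrac{139}{2}}(r-4)\\&+3\sqrt{\tfrac{14}{65}}(r-3)+12\sqrt{\tfrac{26}{55}}(r-3)+2\sqrt{\tfrac{174}{35}}(r-3)+\sqrt{\tfrac{62}{7}}(r-3)+\sqrt{\tfrac{78}{11}}(r-2)\\&+\tfrac{9}{11}\sqrt{\tfrac{43}{2}}(r-2)^2+\tfrac13\sqrt{\tfrac{35}{2}}(2r-5)+\tfrac{1}{26}\sqrt{\tfrac{155}{2}}(3r^2-17r+24)+3\sqrt{\tfrac{6}{13}}(3r^2-15r+19)\end{aligned}$$ and $$\begin{aligned}GA_5(G)={}&c_G+\tfrac{288}{29}\sqrt5(r-4)+\tfrac{48}{11}\sqrt7(r-4)+\tfrac{16}{9}\sqrt{35}(r-4)+\tfrac92\sqrt7(r-3)+\tfrac{36}{11}\sqrt{35}(r-3)\\&+\tfrac{48}{23}\sqrt{385}(r-3)+\tfrac{12}{37}\sqrt{1365}(r-3)+\tfrac{18}{5}\sqrt{11}(r-2)-99r+27r^2+\tfrac{12}{25}\sqrt{429}(3r^2-15r+19).\end{aligned}$$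 -/

import Mathlib

/-! ### Neighbourhood degree sums and the indices `ABC₄`, `GA₅` -/

/-- The neighbourhood degree sum `S_u`: the sum of the degrees of the neighbours of `u`. -/
def nbrDegSum {V : Type*} [Fintype V] (G : SimpleGraph V) [DecidableRel G.Adj] (u : V) : ℕ :=
  ∑ w ∈ G.neighborFinset u, G.degree w

/-- The fourth atom-bond connectivity index: the sum over all edges `uv` of
`√((S_u + S_v - 2) / (S_u S_v))`. -/
noncomputable def ABC4 {V : Type*} [Fintype V] [DecidableEq V]
    (G : SimpleGraph V) [DecidableRel G.Adj] : ℝ :=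
  ∑ e ∈ G.edgeFinset, Sym2.lift
    ⟨fun u v => √(((nbrDegSum G u : ℝ) + (nbrDegSum G v : ℝ) - 2) /
        ((nbrDegSum G u : ℝ) * (nbrDegSum G v : ℝ))),
      fun u v => by
        beta_reduce
        rw [add_comm (nbrDegSum G u : ℝ), mul_comm (nbrDegSum G u : ℝ)]⟩ e

/-- The fifth geometric-arithmetic index: the sum over all edges `uv` of
`2 √(S_u S_v) / (S_u + S_v)`. -/
noncomputable def GA5 {V : Type*} [Fintype V] [DecidableEq V]
    (G : SimpleGraph V) [DecidableRel G.Adj] : ℝ :=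
  ∑ e ∈ G.edgeFinset, Sym2.lift
    ⟨fun u v => 2 * √((nbrDegSum G u : ℝ) * (nbrDegSum G v : ℝ)) /
        ((nbrDegSum G u : ℝ) + (nbrDegSum G v : ℝ)),
      fun u v => by
        beta_reduce
        rw [add_comm (nbrDegSum G u : ℝ), mul_comm (nbrDegSum G u : ℝ)]⟩ e

/-- The edges `uv` of `G` with `{S_u, S_v} = {a, b}`. -/
def edgeClass {V : Type*} [Fintype V] [DecidableEq V]
    (G : SimpleGraph V) [DecidableRel G.Adj] (a b : ℕ) : Finset (Sym2 V) :=
  G.edgeFinset.filter fun e => e.map (nbrDegSum G) = s(a, b)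

/-! ### Replacing every triangle by a planar octahedron -/

/-- The vertices added when all triangles of `H` are replaced by planar octahedra: a triangle `t`
receives three new vertices, the one named `(t, v)` being opposite to the corner `v` of `t`. -/
abbrev OctaNew {V : Type*} (H : SimpleGraph V) : Type _ :=
  {q : Finset V × V // H.IsNClique 3 q.1 ∧ q.2 ∈ q.1}

/-- Adjacency after replacing every triangle `K₃` of `H` by a planar octahedron having that
triangle as its outer face: the edges of `H` stay, the three new vertices of a triangle are pairwise
adjacent, and the new vertex `(t, v)` is joined to the two corners of `t` other than `v`. -/
def octaAdj {V : Type*} (H : SimpleGraph V) : V ⊕ OctaNew H → V ⊕ OctaNew H → Prop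
  | Sum.inl u, Sum.inl v => H.Adj u v
  | Sum.inl u, Sum.inr q => u ∈ q.1.1 ∧ u ≠ q.1.2
  | Sum.inr q, Sum.inl u => u ∈ q.1.1 ∧ u ≠ q.1.2
  | Sum.inr p, Sum.inr q => p.1.1 = q.1.1 ∧ p.1.2 ≠ q.1.2

/-- The graph obtained from `H` by replacing every triangle by a planar octahedron. -/
def octaReplace {V : Type*} (H : SimpleGraph V) : SimpleGraph (V ⊕ OctaNew H) where
  Adj := octaAdj H
  symm := ⟨by
    rintro (u | p) (v | q) h
    · exact H.symm.symm _ _ h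
    · exact h
    · exact h
    · exact ⟨h.1.symm, h.2.symm⟩⟩
  loopless := ⟨by
    rintro (u | p) h
    · exact H.irrefl h
    · exact h.2 rfl⟩

instance {V : Type*} [DecidableEq V] (H : SimpleGraph V) [DecidableRel H.Adj] :
    DecidableRel (octaReplace H).Adj := fun x y =>
  match x, y with
  | Sum.inl u, Sum.inl v => inferInstanceAs (Decidable (H.Adj u v))
  | Sum.inl u, Sum.inr q => inferInstanceAs (Decidable (u ∈ q.1.1 ∧ u ≠ q.1.2))
  | Sum.inr q, Sum.inl u => inferInstanceAs (Decidable (u ∈ q.1.1 ∧ u ≠ q.1.2))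
  | Sum.inr p, Sum.inr q => inferInstanceAs (Decidable (p.1.1 = q.1.1 ∧ p.1.2 ≠ q.1.2))

/-! ### Hexagonal meshes and the networks `HDN3` -/

/-- The vertices of the hexagonal mesh `HX(r)`, in coordinates of the triangular lattice: the
points at lattice distance at most `r - 1` from the origin. -/
noncomputable def hexPoints (r : ℕ) : Finset (ℤ × ℤ) :=
  (Finset.Icc (1 - (r : ℤ)) (r - 1) ×ˢ Finset.Icc (1 - (r : ℤ)) (r - 1)).filter
    fun p => 1 - (r : ℤ) ≤ p.1 + p.2 ∧ p.1 + p.2 ≤ r - 1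

/-- The six nearest-neighbour steps of the triangular lattice. -/
def hexSteps : Finset (ℤ × ℤ) := {(1, 0), (-1, 0), (0, 1), (0, -1), (1, -1), (-1, 1)}

/-- The hexagonal mesh `HX(r)` of dimension `r`. -/
def hexMesh (r : ℕ) : SimpleGraph {p : ℤ × ℤ // p ∈ hexPoints r} where
  Adj p q := q.1 - p.1 ∈ hexSteps
  symm := ⟨by
    rintro ⟨⟨a, b⟩, _⟩ ⟨⟨c, d⟩, _⟩ h
    simp only [hexSteps, Finset.mem_insert, Finset.mem_singleton, Prod.mk_sub_mk,
      Prod.mk.injEq] at h ⊢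
    omega⟩
  loopless := ⟨by
    rintro ⟨⟨a, b⟩, _⟩ h
    simp only [hexSteps, Finset.mem_insert, Finset.mem_singleton, Prod.mk_sub_mk,
      Prod.mk.injEq] at h
    omega⟩

instance (r : ℕ) : DecidableRel (hexMesh r).Adj := fun p q =>
  inferInstanceAs (Decidable (q.1 - p.1 ∈ hexSteps))

instance (r : ℕ) : DecidableEq ({p : ℤ × ℤ // p ∈ hexPoints r} ⊕ OctaNew (hexMesh r)) :=
  instDecidableEqSum

/-- The third type of hex derived network `HDN3(r)`. -/
abbrev HDN3 (r : ℕ) : SimpleGraph ({p : ℤ × ℤ // p ∈ hexPoints r} ⊕ OctaNew (hexMesh r)) :=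
  octaReplace (hexMesh r)

/-- The list of the 32 pairs of neighbourhood degree sums at the ends of the edges of `HDN3(r)`,
each with the number of edges having it. -/
def hdn3Classes (r : ℤ) : List ((ℕ × ℕ) × ℤ) :=
  [((25, 33), 12), ((25, 36), 12), ((25, 54), 12), ((25, 77), 12),
   ((28, 36), 12 * r - 36), ((28, 77), 12), ((28, 80), 12 * r - 48), ((33, 36), 12),
   ((33, 54), 12), ((33, 129), 12), ((36, 36), 12 * r - 30), ((36, 44), 12 * r - 24),
   ((36, 77), 48), ((36, 80), 24 * r - 96), ((36, 129), 24), ((36, 140), 24 * r - 72),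
   ((44, 44), 18 * r ^ 2 - 72 * r + 72), ((44, 129), 36), ((44, 140), 48 * r - 144),
   ((44, 156), 36 * r ^ 2 - 180 * r + 228),
   ((54, 77), 12), ((54, 129), 6), ((77, 80), 12), ((77, 129), 12),
   ((77, 140), 12), ((80, 80), 6 * r - 30), ((80, 140), 12 * r - 48), ((129, 140), 12),
   ((129, 156), 6), ((140, 140), 6 * r - 24), ((140, 156), 12 * r - 36),
   ((156, 156), 9 * r ^ 2 - 51 * r + 72)]

/-! Everything follows from one identity, `sum_edgeFinset_HDN3`: for every symmetric `g`, the sum of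
`g S_u S_v` over the edges of `HDN3 r` equals the sum of (class size) · `g a b` over the 32 listed
classes. Choosing `g` as the summand of either index gives the two formulas. Choosing it as the
indicator of one class gives the size of that class, and as the indicator of the complement of all
classes it shows that no other pair occurs.

To prove the identity, sum over ordered pairs of adjacent vertices, which counts each edge twice.
Every new vertex has degree 4 and its neighbourhood sum is 8 plus the degrees of two corners, so the
sum becomes one over flags `(u, x, y)` of triangles of the mesh
(`two_mul_sum_edgeFinset_octaReplace`). A mesh point has degree 7, 10 or 18 according as it is a
corner, another boundary point or an inner point. Its neighbourhood sum is 54, 77 or 80 on the outer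
ring, 129 or 140 on the ring below it, and 156 further inside.

Rotation by a sixth of a turn preserves all these data, so only flags whose edge points east are
needed (`sum_hexPoints_flagSum`). Reflection in the horizontal axis leaves the rows at height `m ≥
0`. Along a row the contribution is constant apart from two edges at each end. Among the rows
themselves only the two lowest and the two highest are exceptional; those between add up as an
arithmetic progression. The bound `5 ≤ r` leaves room for all these exceptional edges and rows. -/

/-- Summing over ordered pairs of adjacent vertices counts every edge twice. -/
theorem SimpleGraph.sum_neighborFinset_eq_two_nsmul_sum_edgeFinset {W M : Type*} [Fintype W]
    [AddCommMonoid M] (G : SimpleGraph W) [DecidableRel G.Adj] [Fintype G.edgeSet]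
    (f : Sym2 W → M) :
    ∑ x, ∑ y ∈ G.neighborFinset x, f s(x, y) = 2 • ∑ e ∈ G.edgeFinset, f e := by
  classical
  have h1 : ∑ x, ∑ y ∈ G.neighborFinset x, f s(x, y) = ∑ d : G.Dart, f d.edge := by
    rw [Finset.sum_sigma']
    refine Finset.sum_bij' (fun a ha => ⟨(a.1, a.2), by simpa using ha⟩) (fun d _ => ⟨d.fst, d.snd⟩)
      ?_ ?_ ?_ ?_ ?_
    · simp
    · intro d _
      simp
    · simp
    · simp
    · intro a _
      rfl
  rw [h1, ← Finset.sum_fiberwise_of_maps_to (s := (Finset.univ : Finset G.Dart))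
    (t := G.edgeFinset) (g := fun d => d.edge) (by intro d _; simp),
    Finset.smul_sum]
  refine Finset.sum_congr rfl fun e he => ?_
  rw [Finset.sum_congr rfl (g := fun _ => f e) (by intro d hd; rw [(Finset.mem_filter.1 hd).2]),
    Finset.sum_const, G.dart_edge_fiber_card e (by simpa using he)]

/-! ### Edge sums after octahedral replacement, as sums over flags of triangles. -/

section OctaReplace

variable {V M : Type*} [Fintype V] [DecidableEq V] [AddCommMonoid M]
  (H : SimpleGraph V) [DecidableRel H.Adj]

/-- A new vertex joined to `u` is a triangle at `u` with a chosen corner `x ≠ u`; the third corner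
`y` is then determined. Hence these vertices correspond to ordered pairs of adjacent neighbours of
`u`. -/
theorem sum_octaNew_corner (u : V) (φ : Finset V → V → M) :
    ∑ q : OctaNew H, (if u ∈ q.1.1 ∧ u ≠ q.1.2 then φ q.1.1 q.1.2 else 0) =
      ∑ x ∈ H.neighborFinset u, ∑ y ∈ H.neighborFinset u ∩ H.neighborFinset x,
        φ {u, x, y} x := by
  rw [← Finset.sum_filter, Finset.sum_sigma']
  symm
  have key : ∀ a : (_ : V) × V, a ∈ (H.neighborFinset u).sigma
      (fun x => H.neighborFinset u ∩ H.neighborFinset x) →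
      H.Adj u a.1 ∧ H.Adj u a.2 ∧ H.Adj a.1 a.2 := by
    intro a ha
    simpa using ha
  refine Finset.sum_bij (fun a ha => ⟨({u, a.1, a.2}, a.1), ?_, ?_⟩) ?_ ?_ ?_ ?_
  · obtain ⟨h1, h2, h3⟩ := key a ha
    exact SimpleGraph.is3Clique_triple_iff.2 ⟨h1, h2, h3⟩
  · simp
  · intro a ha
    obtain ⟨h1, h2, h3⟩ := key a ha
    simpa using h1.ne
  · rintro ⟨x, y⟩ ha ⟨x', y'⟩ hb h
    obtain ⟨h1, h2, h3⟩ := key _ ha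
    obtain ⟨h1', h2', h3'⟩ := key _ hb
    simp only [Subtype.mk.injEq, Prod.mk.injEq] at h
    obtain ⟨h, rfl⟩ := h
    have hy : y ∈ ({u, x, y'} : Finset V) := by rw [← h]; simp
    simp only [Finset.mem_insert, Finset.mem_singleton] at hy
    rcases hy with hy | hy | hy
    · exact absurd hy h2.ne'
    · exact absurd hy h3.ne'
    · rw [hy]
  · rintro ⟨⟨t, v⟩, ht, hv⟩ hq
    simp only [Finset.mem_filter, Finset.mem_univ, true_and] at hq
    obtain ⟨hu, huv⟩ := hq
    -- Removing `u` and the opposite corner `v` leaves the third corner, which serves as `y`.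
    have hcard : ((t.erase u).erase v).card = 1 := by
      rw [Finset.card_erase_of_mem (Finset.mem_erase.2 ⟨huv.symm, hv⟩),
        Finset.card_erase_of_mem hu, ht.card_eq]
    obtain ⟨w, hw⟩ := Finset.card_eq_one.1 hcard
    have htw : t = {u, v, w} := by
      rw [← Finset.insert_erase hu, ← Finset.insert_erase (Finset.mem_erase.2 ⟨huv.symm, hv⟩), hw]
    subst htw
    obtain ⟨h1, h2, h3⟩ := SimpleGraph.is3Clique_triple_iff.1 ht
    exact ⟨⟨v, w⟩, by simp [h1, h2, h3], rfl⟩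
  · intro a ha
    rfl

theorem sum_octaNew_same (q : OctaNew H) (φ : Finset V → V → M) :
    ∑ p : OctaNew H, (if q.1.1 = p.1.1 ∧ q.1.2 ≠ p.1.2 then φ p.1.1 p.1.2 else 0) =
      ∑ w ∈ q.1.1.erase q.1.2, φ q.1.1 w := by
  rw [← Finset.sum_filter]
  symm
  refine Finset.sum_bij (fun w hw => ⟨(q.1.1, w), q.2.1, Finset.mem_of_mem_erase hw⟩) ?_ ?_ ?_ ?_
  · intro w hw
    simpa using (Finset.ne_of_mem_erase hw).symm
  · intro a _ b _ h
    simpa using h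
  · rintro ⟨⟨t, v⟩, ht, hv⟩ hp
    simp only [Finset.mem_filter, Finset.mem_univ, true_and] at hp
    obtain ⟨rfl, h⟩ := hp
    exact ⟨v, Finset.mem_erase.2 ⟨h.symm, hv⟩, rfl⟩
  · intros
    rfl

/-- Exchanging the two sums groups the pairs by the corner `w`, after which `sum_octaNew_corner`
applies with `u = w`. -/
theorem sum_octaNew_erase (φ : Finset V → V → V → M) :
    ∑ q : OctaNew H, ∑ w ∈ q.1.1.erase q.1.2, φ q.1.1 q.1.2 w =
      ∑ u, ∑ x ∈ H.neighborFinset u, ∑ y ∈ H.neighborFinset u ∩ H.neighborFinset x,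
        φ {u, x, y} x u := by
  rw [Finset.sum_congr rfl fun u _ => (sum_octaNew_corner H u (fun t v => φ t v u)).symm,
    Finset.sum_comm]
  refine Finset.sum_congr rfl fun q _ => ?_
  rw [← Finset.sum_filter]
  refine Finset.sum_congr ?_ fun _ _ => rfl
  ext w
  simp [and_comm]

/-- On new vertices `f` is given through a function `φ` of the bare triangle and corner, so that it
can be evaluated at `{u, x, y}` without carrying a proof that this is a triangle. -/
theorem sum_neighborFinset_inl (u : V) (f : V ⊕ OctaNew H → M) (φ : Finset V → V → M)
    (hf : ∀ q : OctaNew H, f (Sum.inr q) = φ q.1.1 q.1.2) :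
    ∑ y ∈ (octaReplace H).neighborFinset (Sum.inl u), f y =
      ∑ x ∈ H.neighborFinset u, (f (Sum.inl x) +
        ∑ y ∈ H.neighborFinset u ∩ H.neighborFinset x, φ {u, x, y} x) := by
  rw [Finset.sum_add_distrib, ← sum_octaNew_corner, SimpleGraph.neighborFinset_eq_filter,
    Finset.sum_filter, Fintype.sum_sum_type, SimpleGraph.neighborFinset_eq_filter,
    Finset.sum_filter]
  congr 1
  refine Finset.sum_congr rfl fun q _ => ?_
  rw [hf]
  rfl

theorem sum_neighborFinset_inr (q : OctaNew H) (f : V ⊕ OctaNew H → M) (φ : Finset V → V → M)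
    (hf : ∀ q : OctaNew H, f (Sum.inr q) = φ q.1.1 q.1.2) :
    ∑ y ∈ (octaReplace H).neighborFinset (Sum.inr q), f y =
      ∑ w ∈ q.1.1.erase q.1.2, (f (Sum.inl w) + φ q.1.1 w) := by
  rw [Finset.sum_add_distrib, ← sum_octaNew_same, SimpleGraph.neighborFinset_eq_filter,
    Finset.sum_filter, Fintype.sum_sum_type]
  congr 1
  · rw [← Finset.sum_filter]
    refine Finset.sum_congr ?_ fun _ _ => rfl
    ext w
    simp only [Finset.mem_filter, Finset.mem_univ, true_and, Finset.mem_erase]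
    exact and_comm
  · refine Finset.sum_congr rfl fun p _ => ?_
    rw [hf]
    rfl

theorem degree_octaReplace_inr (q : OctaNew H) : (octaReplace H).degree (Sum.inr q) = 4 := by
  rw [← SimpleGraph.card_neighborFinset_eq_degree, Finset.card_eq_sum_ones,
    sum_neighborFinset_inr H q (fun _ => 1) (fun _ _ => 1) fun _ => rfl, Finset.sum_const,
    Finset.card_erase_of_mem q.2.2, q.2.1.card_eq]
  rfl

theorem degree_octaReplace_inl (u : V) : (octaReplace H).degree (Sum.inl u) =
    ∑ x ∈ H.neighborFinset u, (1 + ∑ _y ∈ H.neighborFinset u ∩ H.neighborFinset x, 1) := by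
  rw [← SimpleGraph.card_neighborFinset_eq_degree, Finset.card_eq_sum_ones,
    sum_neighborFinset_inl H u (fun _ => 1) (fun _ _ => 1) fun _ => rfl]

theorem nbrDegSum_octaReplace_inl (u : V) : nbrDegSum (octaReplace H) (Sum.inl u) =
    ∑ x ∈ H.neighborFinset u, ((octaReplace H).degree (Sum.inl x) +
      ∑ _y ∈ H.neighborFinset u ∩ H.neighborFinset x, 4) :=
  sum_neighborFinset_inl H u _ (fun _ _ => 4) (degree_octaReplace_inr H)

theorem nbrDegSum_octaReplace_inr (q : OctaNew H) : nbrDegSum (octaReplace H) (Sum.inr q) =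
    8 + ∑ w ∈ q.1.1.erase q.1.2, (octaReplace H).degree (Sum.inl w) := by
  rw [nbrDegSum, sum_neighborFinset_inr H q _ (fun _ _ => 4) (degree_octaReplace_inr H),
    Finset.sum_add_distrib, Finset.sum_const, Finset.card_erase_of_mem q.2.2, q.2.1.card_eq,
    add_comm]
  rfl

/-- The sum of a symmetric function of the neighbourhood degree sums over the edges of the graph
obtained by replacing triangles by octahedra, as a sum over the flags of the original graph. -/
theorem two_mul_sum_edgeFinset_octaReplace {g : ℕ → ℕ → ℝ} (hg : ∀ a b, g a b = g b a)
    [DecidableEq (V ⊕ OctaNew H)] {d S : V → ℕ}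
    (hd : ∀ u, (octaReplace H).degree (Sum.inl u) = d u)
    (hS : ∀ u, nbrDegSum (octaReplace H) (Sum.inl u) = S u) :
    2 * ∑ e ∈ (octaReplace H).edgeFinset, Sym2.lift ⟨fun x y =>
      g (nbrDegSum (octaReplace H) x) (nbrDegSum (octaReplace H) y), fun _ _ => hg _ _⟩ e =
    ∑ u, ∑ x ∈ H.neighborFinset u, (g (S u) (S x) +
      ∑ y ∈ H.neighborFinset u ∩ H.neighborFinset x,
        (2 * g (S u) (8 + (d u + d y)) + g (8 + (d x + d y)) (8 + (d u + d y)))) := by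
  -- `N t v` is the neighbourhood sum of the new vertex `(t, v)`: two new neighbours of degree 4 and
  -- the two corners other than `v`.
  set N : Finset V → V → ℕ := fun t v => 8 + ∑ w ∈ t.erase v, d w with hN
  have hq : ∀ q : OctaNew H, nbrDegSum (octaReplace H) (Sum.inr q) = N q.1.1 q.1.2 := by
    intro q
    simp only [nbrDegSum_octaReplace_inr, hd, hN]
  have h2 := SimpleGraph.sum_neighborFinset_eq_two_nsmul_sum_edgeFinset (octaReplace H)
    (Sym2.lift ⟨fun x y =>
      g (nbrDegSum (octaReplace H) x) (nbrDegSum (octaReplace H) y), fun _ _ => hg _ _⟩)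
  rw [two_nsmul, ← two_mul] at h2
  rw [← h2, Fintype.sum_sum_type]
  simp only [Sym2.lift_mk]
  have h3 (u : V) := sum_neighborFinset_inl H u (fun y => g (S u)
    (nbrDegSum (octaReplace H) y)) (fun t v => g (S u) (N t v)) (fun q => by rw [hq])
  have h4 (q : OctaNew H) := sum_neighborFinset_inr H q (fun y => g (N q.1.1 q.1.2)
    (nbrDegSum (octaReplace H) y)) (fun t v => g (N q.1.1 q.1.2) (N t v)) (fun p => by rw [hq])
  simp only [hS] at h3 h4
  simp only [hS, hq, h3, h4]
  -- Ordered pairs starting at a new vertex `(t, v)` end at a corner `w` or at the new vertex `(t,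
  -- w)`, with `w ≠ v` in both cases, so both kinds are indexed by the same flags.
  rw [sum_octaNew_erase H (fun t v w => g (N t v) (S w) + g (N t v) (N t w)),
    ← Finset.sum_add_distrib]
  refine Finset.sum_congr rfl fun u _ => ?_
  rw [← Finset.sum_add_distrib]
  refine Finset.sum_congr rfl fun x hx => ?_
  rw [add_assoc, ← Finset.sum_add_distrib]
  congr 1
  refine Finset.sum_congr rfl fun y hy => ?_
  simp only [SimpleGraph.mem_neighborFinset, Finset.mem_inter] at hx hy
  have e1 : N {u, x, y} x = 8 + (d u + d y) := by
    have : ({u, x, y} : Finset V).erase x = {u, y} := by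
      ext w
      simp only [Finset.mem_erase, Finset.mem_insert, Finset.mem_singleton]
      constructor
      · tauto
      · rintro (rfl | rfl)
        · exact ⟨hx.ne, by simp⟩
        · exact ⟨hy.2.ne', by simp⟩
    rw [hN]
    simp only [this, Finset.sum_pair hy.1.ne]
  have e2 : N {u, x, y} u = 8 + (d x + d y) := by
    have : ({u, x, y} : Finset V).erase u = {x, y} :=
      Finset.erase_insert (by simp [hx.ne, hy.1.ne])
    rw [hN]
    simp only [this, Finset.sum_pair hy.2.ne]
  rw [e1, e2, hg (8 + (d u + d y)) (S u), hg (8 + (d u + d y)) (8 + (d x + d y))]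
  ring

end OctaReplace

/-! ### Sixfold rotation of the lattice and of the mesh. -/

/-- The rotation of the triangular lattice by a sixth of a turn about the origin. -/
def hexRot : ℤ × ℤ ≃ ℤ × ℤ where
  toFun p := (-p.2, p.1 + p.2)
  invFun p := (p.1 + p.2, -p.1)
  left_inv := by rintro ⟨a, b⟩; simp
  right_inv := by rintro ⟨a, b⟩; simp

theorem hexRot_apply (a b : ℤ) : hexRot (a, b) = (-b, a + b) := rfl

theorem hexRot_symm_apply (a b : ℤ) : hexRot.symm (a, b) = (a + b, -a) := rfl

theorem hexRot_add (p q : ℤ × ℤ) : hexRot (p + q) = hexRot p + hexRot q := by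
  obtain ⟨a, b⟩ := p
  obtain ⟨c, d⟩ := q
  simp only [Prod.mk_add_mk, hexRot_apply, Prod.mk.injEq]
  constructor <;> ring

theorem mem_hexPoints {r : ℕ} {a b : ℤ} : (a, b) ∈ hexPoints r ↔
    1 - (r : ℤ) ≤ a ∧ a ≤ r - 1 ∧ 1 - (r : ℤ) ≤ b ∧ b ≤ r - 1 ∧
      1 - (r : ℤ) ≤ a + b ∧ a + b ≤ r - 1 := by
  simp only [hexPoints, Finset.mem_filter, Finset.mem_product, Finset.mem_Icc]
  tauto

theorem hexRot_mem_hexPoints {r : ℕ} {p : ℤ × ℤ} : hexRot p ∈ hexPoints r ↔ p ∈ hexPoints r := by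
  obtain ⟨a, b⟩ := p
  rw [hexRot_apply, mem_hexPoints, mem_hexPoints]
  omega

theorem hexRot_mem_hexSteps {s : ℤ × ℤ} : hexRot s ∈ hexSteps ↔ s ∈ hexSteps := by
  obtain ⟨a, b⟩ := s
  simp only [hexRot_apply, hexSteps, Finset.mem_insert, Finset.mem_singleton, Prod.mk.injEq]
  omega

theorem sum_hexSteps {M : Type*} [AddCommMonoid M] (f : ℤ × ℤ → M) :
    ∑ s ∈ hexSteps, f s =
      f (1, 0) + (f (-1, 0) + (f (0, 1) + (f (0, -1) + (f (1, -1) + f (-1, 1))))) := by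
  simp [hexSteps]

theorem sum_hexSteps_hexRot {M : Type*} [AddCommMonoid M] (f : ℤ × ℤ → M) :
    ∑ s ∈ hexSteps, f (hexRot s) = ∑ s ∈ hexSteps, f s :=
  Finset.sum_equiv hexRot (fun _ => hexRot_mem_hexSteps.symm) fun _ _ => rfl

theorem sum_hexPoints_hexRot {M : Type*} [AddCommMonoid M] (r : ℕ) (f : ℤ × ℤ → M) :
    ∑ p ∈ hexPoints r, f (hexRot p) = ∑ p ∈ hexPoints r, f p :=
  Finset.sum_equiv hexRot (fun _ => hexRot_mem_hexPoints.symm) fun _ _ => rfl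

/-- Two steps lead to adjacent points exactly when they differ by a sixth of a turn. So an edge in
direction `s` lies in two lattice triangles, whose third corners are reached by the two rotations of
`s`. -/
theorem filter_hexSteps_sub_mem : ∀ s ∈ hexSteps,
    hexSteps.filter (fun t => t - s ∈ hexSteps) = {hexRot s, hexRot.symm s} ∧
      hexRot s ≠ hexRot.symm s := by
  decide

/-! ### Flag sums of the mesh in lattice coordinates. -/

section FlagSum

variable {M : Type*} [AddCommMonoid M]

/-- The contribution of the edge from `u` to `u + s` and of the two triangles at this edge. -/
noncomputable def flagSum (r : ℕ) (F : ℤ × ℤ → ℤ × ℤ → M) (A : ℤ × ℤ → ℤ × ℤ → ℤ × ℤ → M)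
    (u s : ℤ × ℤ) : M :=
  if u + s ∈ hexPoints r then F u (u + s) +
    ((if u + hexRot s ∈ hexPoints r then A u (u + s) (u + hexRot s) else 0) +
      if u + hexRot.symm s ∈ hexPoints r then A u (u + s) (u + hexRot.symm s) else 0)
  else 0

theorem sum_hexMesh_neighborFinset {r : ℕ} (u : {p : ℤ × ℤ // p ∈ hexPoints r})
    (f : ℤ × ℤ → M) :
    ∑ x ∈ (hexMesh r).neighborFinset u, f x.1 =
      ∑ s ∈ hexSteps, if u.1 + s ∈ hexPoints r then f (u.1 + s) else 0 := by
  rw [← Finset.sum_filter]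
  refine Finset.sum_bij (fun x _ => x.1 - u.1) ?_ ?_ ?_ ?_
  · intro x hx
    rw [SimpleGraph.mem_neighborFinset] at hx
    exact Finset.mem_filter.2 ⟨hx, by simp⟩
  · intro x _ y _ h
    exact Subtype.ext (by simpa using h)
  · intro s hs
    obtain ⟨h1, h2⟩ := Finset.mem_filter.1 hs
    refine ⟨⟨u.1 + s, h2⟩, ?_, by simp⟩
    rw [SimpleGraph.mem_neighborFinset]
    change u.1 + s - u.1 ∈ hexSteps
    simpa using h1
  · intro x _
    simp

theorem sum_hexMesh_neighborFinset_inter {r : ℕ} {u x : {p : ℤ × ℤ // p ∈ hexPoints r}}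
    {s : ℤ × ℤ} (hs : s ∈ hexSteps) (hx : x.1 = u.1 + s) (f : ℤ × ℤ → M) :
    ∑ y ∈ (hexMesh r).neighborFinset u ∩ (hexMesh r).neighborFinset x, f y.1 =
      (if u.1 + hexRot s ∈ hexPoints r then f (u.1 + hexRot s) else 0) +
        if u.1 + hexRot.symm s ∈ hexPoints r then f (u.1 + hexRot.symm s) else 0 := by
  have h1 : ∑ y ∈ (hexMesh r).neighborFinset u ∩ (hexMesh r).neighborFinset x, f y.1 =
      ∑ y ∈ (hexMesh r).neighborFinset u, if y.1 - x.1 ∈ hexSteps then f y.1 else 0 := by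
    rw [← Finset.sum_filter]
    refine Finset.sum_congr ?_ fun _ _ => rfl
    ext y
    rw [Finset.mem_inter, Finset.mem_filter, SimpleGraph.mem_neighborFinset _ x]
    rfl
  rw [h1, sum_hexMesh_neighborFinset u fun y => if y - x.1 ∈ hexSteps then f y else 0]
  obtain ⟨h2, h3⟩ := filter_hexSteps_sub_mem s hs
  rw [← Finset.sum_pair (f := fun t => if u.1 + t ∈ hexPoints r then f (u.1 + t) else 0) h3,
    ← h2, Finset.sum_filter]
  refine Finset.sum_congr rfl fun t _ => ?_
  rw [hx, add_sub_add_left_eq_sub]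
  split_ifs <;> rfl

/-- This replaces neighbourhoods in the subtype of mesh points by a sum over six fixed steps with
membership tests, the form in which rotations act. -/
theorem sum_hexMesh_flags {r : ℕ} (u : {p : ℤ × ℤ // p ∈ hexPoints r})
    (F : ℤ × ℤ → ℤ × ℤ → M) (A : ℤ × ℤ → ℤ × ℤ → ℤ × ℤ → M) :
    ∑ x ∈ (hexMesh r).neighborFinset u, (F u.1 x.1 +
      ∑ y ∈ (hexMesh r).neighborFinset u ∩ (hexMesh r).neighborFinset x, A u.1 x.1 y.1) =
    ∑ s ∈ hexSteps, flagSum r F A u.1 s := by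
  have h1 : ∀ x ∈ (hexMesh r).neighborFinset u, F u.1 x.1 +
      ∑ y ∈ (hexMesh r).neighborFinset u ∩ (hexMesh r).neighborFinset x, A u.1 x.1 y.1 =
      flagSum r F A u.1 (x.1 - u.1) := by
    intro x hx
    rw [SimpleGraph.mem_neighborFinset] at hx
    have h2 : x.1 = u.1 + (x.1 - u.1) := by abel
    rw [sum_hexMesh_neighborFinset_inter (s := x.1 - u.1) hx h2 fun y => A u.1 x.1 y, flagSum,
      ← h2, if_pos x.2]
  rw [Finset.sum_congr rfl h1,
    sum_hexMesh_neighborFinset u fun x => flagSum r F A u.1 (x - u.1)]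
  refine Finset.sum_congr rfl fun s _ => ?_
  rw [add_sub_cancel_left]
  split_ifs with h
  · rfl
  · rw [flagSum, if_neg h]

theorem flagSum_hexRot (r : ℕ) {F : ℤ × ℤ → ℤ × ℤ → M} {A : ℤ × ℤ → ℤ × ℤ → ℤ × ℤ → M}
    (hF : ∀ u x, F (hexRot u) (hexRot x) = F u x)
    (hA : ∀ u x y, A (hexRot u) (hexRot x) (hexRot y) = A u x y) (u s : ℤ × ℤ) :
    flagSum r F A (hexRot u) (hexRot s) = flagSum r F A u s := by
  have h : hexRot u + hexRot.symm (hexRot s) = hexRot (u + hexRot.symm s) := by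
    rw [hexRot_add, Equiv.symm_apply_apply, Equiv.apply_symm_apply]
  simp only [flagSum, h, ← hexRot_add, hexRot_mem_hexPoints, hF, hA]

theorem sum_hexSteps_flagSum_hexRot (r : ℕ) {F : ℤ × ℤ → ℤ × ℤ → M}
    {A : ℤ × ℤ → ℤ × ℤ → ℤ × ℤ → M} (hF : ∀ u x, F (hexRot u) (hexRot x) = F u x)
    (hA : ∀ u x y, A (hexRot u) (hexRot x) (hexRot y) = A u x y) (u : ℤ × ℤ) :
    ∑ s ∈ hexSteps, flagSum r F A (hexRot u) s = ∑ s ∈ hexSteps, flagSum r F A u s := by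
  rw [← sum_hexSteps_hexRot]
  exact Finset.sum_congr rfl fun s _ => flagSum_hexRot r hF hA u s

/-- The six steps form one orbit of the rotation, and rotating the base point as well leaves the
total for each step unchanged. -/
theorem sum_hexPoints_flagSum (r : ℕ) {F : ℤ × ℤ → ℤ × ℤ → M} {A : ℤ × ℤ → ℤ × ℤ → ℤ × ℤ → M}
    (hF : ∀ u x, F (hexRot u) (hexRot x) = F u x)
    (hA : ∀ u x y, A (hexRot u) (hexRot x) (hexRot y) = A u x y) :
    ∑ u ∈ hexPoints r, ∑ s ∈ hexSteps, flagSum r F A u s =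
      6 • ∑ u ∈ hexPoints r, flagSum r F A u (1, 0) := by
  have h1 (s : ℤ × ℤ) : ∑ u ∈ hexPoints r, flagSum r F A u (hexRot s) =
      ∑ u ∈ hexPoints r, flagSum r F A u s := by
    rw [← sum_hexPoints_hexRot]
    exact Finset.sum_congr rfl fun u _ => flagSum_hexRot r hF hA u s
  have e1 := h1 (1, 0)
  have e2 := h1 (0, 1)
  have e3 := h1 (-1, 1)
  have e4 := h1 (-1, 0)
  have e5 := h1 (0, -1)
  simp only [hexRot_apply, neg_zero, neg_neg, add_zero, zero_add, neg_add_cancel] at e1 e2 e3 e4 e5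
  rw [Finset.sum_comm, sum_hexSteps, e5, e4, e3, e2, e1]
  simp only [succ_nsmul, zero_nsmul, zero_add, add_assoc]

end FlagSum

/-- The closed sector `0 ≤ a`, `0 ≤ b` and its five rotated copies cover the lattice, so
rotation-invariant facts need checking only there. -/
theorem hexRot_induction {P : ℤ × ℤ → Prop} (hrot : ∀ p, P p → P (hexRot p))
    (hP : ∀ a b : ℤ, 0 ≤ a → 0 ≤ b → P (a, b)) (p : ℤ × ℤ) : P p := by
  have back (a b : ℤ) (h : P (a + b, -a)) : P (a, b) := by
    have := hrot _ h
    rwa [hexRot_apply, neg_neg, add_neg_eq_of_eq_add (add_comm a b)] at this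
  have h1 (a b : ℤ) (ha : a ≤ 0) (hb : 0 ≤ a + b) : P (a, b) := back _ _ (hP _ _ hb (by omega))
  have h2 (a b : ℤ) (ha : a + b ≤ 0) (hb : 0 ≤ b) : P (a, b) :=
    back _ _ (h1 _ _ ha (by omega))
  have h3 (a b : ℤ) (ha : a ≤ 0) (hb : b ≤ 0) : P (a, b) :=
    back _ _ (h2 _ _ (by omega) (by omega))
  have h4 (a b : ℤ) (ha : 0 ≤ a) (hb : a + b ≤ 0) : P (a, b) :=
    back _ _ (h3 _ _ (by omega) (by omega))
  have h5 (a b : ℤ) (ha : 0 ≤ a + b) (hb : b ≤ 0) : P (a, b) :=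
    back _ _ (h4 _ _ (by omega) (by omega))
  obtain ⟨a, b⟩ := p
  rcases le_total 0 a with ha | ha <;> rcases le_total 0 b with hb | hb <;>
    rcases le_total 0 (a + b) with hc | hc
  · exact hP a b ha hb
  · exact hP a b ha hb
  · exact h5 a b hc hb
  · exact h4 a b ha hc
  · exact h1 a b ha hc
  · exact h2 a b hc hb
  · exact h3 a b ha hb
  · exact h3 a b ha hb

/-! ### Degrees and neighbourhood sums of mesh points. -/

/-- The distance from the origin in the triangular lattice. -/
def hexNorm (p : ℤ × ℤ) : ℤ :=
  max (max (max p.1 (-p.1)) (max p.2 (-p.2))) (max (p.1 + p.2) (-(p.1 + p.2)))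

/-- The degree of a point of the mesh with outermost ring `n` in the hex derived network. -/
def hexDeg (n : ℤ) (p : ℤ × ℤ) : ℕ :=
  if hexNorm p = n then
    if p.1 = 0 ∨ p.2 = 0 ∨ p.1 + p.2 = 0 then 7 else 10
  else 18

/-- The neighbourhood degree sum of a point of the mesh with outermost ring `n` in the hex derived
network. -/
def hexDegSum (n : ℤ) (p : ℤ × ℤ) : ℕ :=
  if hexNorm p = n then
    if p.1 = 0 ∨ p.2 = 0 ∨ p.1 + p.2 = 0 then 54
    else if p.1 = 1 ∨ p.1 = -1 ∨ p.2 = 1 ∨ p.2 = -1 ∨ p.1 + p.2 = 1 ∨ p.1 + p.2 = -1 then 77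
    else 80
  else if hexNorm p = n - 1 then
    if p.1 = 0 ∨ p.2 = 0 ∨ p.1 + p.2 = 0 then 129 else 140
  else 156

theorem hexNorm_hexRot (p : ℤ × ℤ) : hexNorm (hexRot p) = hexNorm p := by
  obtain ⟨a, b⟩ := p
  simp only [hexRot_apply, hexNorm]
  omega

theorem hexDeg_hexRot (n : ℤ) (p : ℤ × ℤ) : hexDeg n (hexRot p) = hexDeg n p := by
  have h : (hexRot p).1 = 0 ∨ (hexRot p).2 = 0 ∨ (hexRot p).1 + (hexRot p).2 = 0 ↔
      p.1 = 0 ∨ p.2 = 0 ∨ p.1 + p.2 = 0 := by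
    obtain ⟨a, b⟩ := p
    simp only [hexRot_apply]
    omega
  simp only [hexDeg, hexNorm_hexRot, h]

theorem hexDegSum_hexRot (n : ℤ) (p : ℤ × ℤ) : hexDegSum n (hexRot p) = hexDegSum n p := by
  have h : (hexRot p).1 = 0 ∨ (hexRot p).2 = 0 ∨ (hexRot p).1 + (hexRot p).2 = 0 ↔
      p.1 = 0 ∨ p.2 = 0 ∨ p.1 + p.2 = 0 := by
    obtain ⟨a, b⟩ := p
    simp only [hexRot_apply]
    omega
  have h' : (hexRot p).1 = 1 ∨ (hexRot p).1 = -1 ∨ (hexRot p).2 = 1 ∨ (hexRot p).2 = -1 ∨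
      (hexRot p).1 + (hexRot p).2 = 1 ∨ (hexRot p).1 + (hexRot p).2 = -1 ↔
      p.1 = 1 ∨ p.1 = -1 ∨ p.2 = 1 ∨ p.2 = -1 ∨ p.1 + p.2 = 1 ∨ p.1 + p.2 = -1 := by
    obtain ⟨a, b⟩ := p
    simp only [hexRot_apply]
    omega
  simp only [hexDegSum, hexNorm_hexRot, h, h']

theorem hexDeg_eq_ite (n a b : ℤ) : hexDeg n (a, b) =
    if hexNorm (a, b) = n then if a = 0 ∨ b = 0 ∨ a + b = 0 then 7 else 10 else 18 := rfl

theorem hexDegSum_eq_ite (n a b : ℤ) : hexDegSum n (a, b) =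
  if hexNorm (a, b) = n then
    if a = 0 ∨ b = 0 ∨ a + b = 0 then 54
    else if a = 1 ∨ a = -1 ∨ b = 1 ∨ b = -1 ∨ a + b = 1 ∨ a + b = -1 then 77
    else 80
  else if hexNorm (a, b) = n - 1 then if a = 0 ∨ b = 0 ∨ a + b = 0 then 129 else 140
  else 156 := rfl

theorem hexNorm_eq_ite (a b : ℤ) : hexNorm (a, b) =
    if 0 ≤ b then if 0 ≤ a then a + b else if 0 ≤ a + b then b else -a
    else if a ≤ 0 then -(a + b) else if 0 ≤ a + b then a else -b := by
  simp only [hexNorm]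
  split_ifs <;> omega

theorem not_mem_hexPoints_of {r : ℕ} {a b : ℤ}
    (h : (r : ℤ) ≤ a ∨ (r : ℤ) ≤ b ∨ (r : ℤ) ≤ a + b) : (a, b) ∉ hexPoints r := by
  rw [mem_hexPoints]
  omega

/-! ### Values of both functions at points of each position. -/

section ClosedForms

variable {n a b : ℤ}

/-- The side conditions here and below are default arguments proved by `omega`, so that later
computations need only name the position of a point. -/
theorem hexDeg_corner_east (hn : 0 < n := by omega) (ha : a = n := by omega)
    (hb : b = 0 := by omega) : hexDeg n (a, b) = 7 := by
  simp only [hexDeg_eq_ite, hexNorm_eq_ite]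
  split_ifs <;> omega

theorem hexDeg_corner_northeast (hn : 0 < n := by omega) (ha : a = 0 := by omega)
    (hb : b = n := by omega) : hexDeg n (a, b) = 7 := by
  simp only [hexDeg_eq_ite, hexNorm_eq_ite]
  split_ifs <;> omega

theorem hexDeg_corner_northwest (hn : 0 < n := by omega) (ha : a = -n := by omega)
    (hb : b = n := by omega) : hexDeg n (a, b) = 7 := by
  simp only [hexDeg_eq_ite, hexNorm_eq_ite]
  split_ifs <;> omega

theorem hexDeg_corner_west (hn : 0 < n := by omega) (ha : a = -n := by omega)
    (hb : b = 0 := by omega) : hexDeg n (a, b) = 7 := by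
  simp only [hexDeg_eq_ite, hexNorm_eq_ite]
  split_ifs <;> omega

theorem hexDeg_side_east (h : a + b = n := by omega) (ha : 0 < a := by omega)
    (hb : 0 < b := by omega) : hexDeg n (a, b) = 10 := by
  simp only [hexDeg_eq_ite, hexNorm_eq_ite]
  split_ifs <;> omega

theorem hexDeg_side_southeast (ha : a = n := by omega) (h : 0 < a + b := by omega)
    (hb : b < 0 := by omega) : hexDeg n (a, b) = 10 := by
  simp only [hexDeg_eq_ite, hexNorm_eq_ite]
  split_ifs <;> omega

theorem hexDeg_side_north (hb : b = n := by omega) (h : 0 < a + b := by omega)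
    (ha : a < 0 := by omega) : hexDeg n (a, b) = 10 := by
  simp only [hexDeg_eq_ite, hexNorm_eq_ite]
  split_ifs <;> omega

theorem hexDeg_side_west (ha : a = -n := by omega) (h : a + b < 0 := by omega)
    (hb : 0 < b := by omega) : hexDeg n (a, b) = 10 := by
  simp only [hexDeg_eq_ite, hexNorm_eq_ite]
  split_ifs <;> omega

theorem hexDeg_side_southwest (h : a + b = -n := by omega) (ha : a < 0 := by omega)
    (hb : b < 0 := by omega) : hexDeg n (a, b) = 10 := by
  simp only [hexDeg_eq_ite, hexNorm_eq_ite]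
  split_ifs <;> omega

theorem hexDeg_interior (h : -n < a ∧ a < n ∧ -n < b ∧ b < n ∧ -n < a + b ∧ a + b < n := by omega)
    : hexDeg n (a, b) = 18 := by
  simp only [hexDeg_eq_ite, hexNorm_eq_ite]
  split_ifs <;> omega

theorem hexDegSum_corner_east (hn : 0 < n := by omega) (ha : a = n := by omega)
    (hb : b = 0 := by omega) : hexDegSum n (a, b) = 54 := by
  simp only [hexDegSum_eq_ite, hexNorm_eq_ite]
  split_ifs <;> omega

theorem hexDegSum_corner_northeast (hn : 0 < n := by omega) (ha : a = 0 := by omega)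
    (hb : b = n := by omega) : hexDegSum n (a, b) = 54 := by
  simp only [hexDegSum_eq_ite, hexNorm_eq_ite]
  split_ifs <;> omega

theorem hexDegSum_corner_northwest (hn : 0 < n := by omega) (ha : a = -n := by omega)
    (hb : b = n := by omega) : hexDegSum n (a, b) = 54 := by
  simp only [hexDegSum_eq_ite, hexNorm_eq_ite]
  split_ifs <;> omega

theorem hexDegSum_corner_west (hn : 0 < n := by omega) (ha : a = -n := by omega)
    (hb : b = 0 := by omega) : hexDegSum n (a, b) = 54 := by
  simp only [hexDegSum_eq_ite, hexNorm_eq_ite]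
  split_ifs <;> omega

theorem hexDegSum_next_east (hn : 1 < n := by omega) (ha : a = n - 1 := by omega)
    (hb : b = 1 := by omega) : hexDegSum n (a, b) = 77 := by
  simp only [hexDegSum_eq_ite, hexNorm_eq_ite]
  split_ifs <;> omega

theorem hexDegSum_next_northeast (hn : 1 < n := by omega) (ha : a = 1 := by omega)
    (hb : b = n - 1 := by omega) : hexDegSum n (a, b) = 77 := by
  simp only [hexDegSum_eq_ite, hexNorm_eq_ite]
  split_ifs <;> omega

theorem hexDegSum_next_north (hn : 1 < n := by omega) (ha : a = -1 := by omega)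
    (hb : b = n := by omega) : hexDegSum n (a, b) = 77 := by
  simp only [hexDegSum_eq_ite, hexNorm_eq_ite]
  split_ifs <;> omega

theorem hexDegSum_next_northwest (hn : 1 < n := by omega) (ha : a = 1 - n := by omega)
    (hb : b = n := by omega) : hexDegSum n (a, b) = 77 := by
  simp only [hexDegSum_eq_ite, hexNorm_eq_ite]
  split_ifs <;> omega

theorem hexDegSum_next_west (hn : 1 < n := by omega) (ha : a = -n := by omega)
    (hb : b = n - 1 := by omega) : hexDegSum n (a, b) = 77 := by
  simp only [hexDegSum_eq_ite, hexNorm_eq_ite]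
  split_ifs <;> omega

theorem hexDegSum_next_southwest (hn : 1 < n := by omega) (ha : a = -n := by omega)
    (hb : b = 1 := by omega) : hexDegSum n (a, b) = 77 := by
  simp only [hexDegSum_eq_ite, hexNorm_eq_ite]
  split_ifs <;> omega

theorem hexDegSum_side_east (h : a + b = n := by omega) (ha : 1 < a := by omega)
    (hb : 1 < b := by omega) : hexDegSum n (a, b) = 80 := by
  simp only [hexDegSum_eq_ite, hexNorm_eq_ite]
  split_ifs <;> omega

theorem hexDegSum_side_north (hb : b = n := by omega) (h : 1 < a + b := by omega)
    (ha : a < -1 := by omega) : hexDegSum n (a, b) = 80 := by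
  simp only [hexDegSum_eq_ite, hexNorm_eq_ite]
  split_ifs <;> omega

theorem hexDegSum_side_west (ha : a = -n := by omega) (h : a + b < -1 := by omega)
    (hb : 1 < b := by omega) : hexDegSum n (a, b) = 80 := by
  simp only [hexDegSum_eq_ite, hexNorm_eq_ite]
  split_ifs <;> omega

theorem hexDegSum_inner_corner_east (hn : 1 < n := by omega) (ha : a = n - 1 := by omega)
    (hb : b = 0 := by omega) : hexDegSum n (a, b) = 129 := by
  simp only [hexDegSum_eq_ite, hexNorm_eq_ite]
  split_ifs <;> omega

theorem hexDegSum_inner_corner_northeast (hn : 1 < n := by omega) (ha : a = 0 := by omega)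
    (hb : b = n - 1 := by omega) : hexDegSum n (a, b) = 129 := by
  simp only [hexDegSum_eq_ite, hexNorm_eq_ite]
  split_ifs <;> omega

theorem hexDegSum_inner_corner_northwest (hn : 1 < n := by omega) (ha : a = 1 - n := by omega)
    (hb : b = n - 1 := by omega) : hexDegSum n (a, b) = 129 := by
  simp only [hexDegSum_eq_ite, hexNorm_eq_ite]
  split_ifs <;> omega

theorem hexDegSum_inner_corner_west (hn : 1 < n := by omega) (ha : a = 1 - n := by omega)
    (hb : b = 0 := by omega) : hexDegSum n (a, b) = 129 := by
  simp only [hexDegSum_eq_ite, hexNorm_eq_ite]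
  split_ifs <;> omega

theorem hexDegSum_inner_side_east (h : a + b = n - 1 := by omega) (ha : 0 < a := by omega)
    (hb : 0 < b := by omega) : hexDegSum n (a, b) = 140 := by
  simp only [hexDegSum_eq_ite, hexNorm_eq_ite]
  split_ifs <;> omega

theorem hexDegSum_inner_side_north (hb : b = n - 1 := by omega) (h : 0 < a + b := by omega)
    (ha : a < 0 := by omega) : hexDegSum n (a, b) = 140 := by
  simp only [hexDegSum_eq_ite, hexNorm_eq_ite]
  split_ifs <;> omega

theorem hexDegSum_inner_side_west (ha : a = 1 - n := by omega) (h : a + b < 0 := by omega)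
    (hb : 0 < b := by omega) : hexDegSum n (a, b) = 140 := by
  simp only [hexDegSum_eq_ite, hexNorm_eq_ite]
  split_ifs <;> omega

theorem hexDegSum_interior
    (h : 1 - n < a ∧ a < n - 1 ∧ 1 - n < b ∧ b < n - 1 ∧ 1 - n < a + b ∧ a + b < n - 1 :=
      by omega)
    : hexDegSum n (a, b) = 156 := by
  simp only [hexDegSum_eq_ite, hexNorm_eq_ite]
  split_ifs <;> omega

end ClosedForms

/-! ### Flag sums at a point of the sector, and the degrees they yield. -/

section FlagSumSector

variable {M : Type*} [AddCommMonoid M] {r : ℕ} (F : ℤ × ℤ → ℤ × ℤ → M)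
  (A : ℤ × ℤ → ℤ × ℤ → ℤ × ℤ → M) {a b : ℤ}

theorem sum_flagSum_interior (ha : 0 ≤ a) (hb : 0 ≤ b) (h : a + b < r - 1) :
    ∑ s ∈ hexSteps, flagSum r F A (a, b) s =
      (F (a, b) (a + 1, b) +
        (A (a, b) (a + 1, b) (a, b + 1) + A (a, b) (a + 1, b) (a + 1, b + -1))) + (
      (F (a, b) (a + -1, b) +
        (A (a, b) (a + -1, b) (a, b + -1) + A (a, b) (a + -1, b) (a + -1, b + 1))) + (
      (F (a, b) (a, b + 1) +
        (A (a, b) (a, b + 1) (a + -1, b + 1) + A (a, b) (a, b + 1) (a + 1, b))) + (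
      (F (a, b) (a, b + -1) +
        (A (a, b) (a, b + -1) (a + 1, b + -1) + A (a, b) (a, b + -1) (a + -1, b))) + (
      (F (a, b) (a + 1, b + -1) +
        (A (a, b) (a + 1, b + -1) (a + 1, b) + A (a, b) (a + 1, b + -1) (a, b + -1))) +
      (F (a, b) (a + -1, b + 1) +
        (A (a, b) (a + -1, b + 1) (a + -1, b) + A (a, b) (a + -1, b + 1) (a, b + 1))))))) := by
  have he : (a + 1, b) ∈ hexPoints r := mem_hexPoints.2 (by omega)
  have hw : (a + -1, b) ∈ hexPoints r := mem_hexPoints.2 (by omega)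
  have hn : (a, b + 1) ∈ hexPoints r := mem_hexPoints.2 (by omega)
  have hs : (a, b + -1) ∈ hexPoints r := mem_hexPoints.2 (by omega)
  have hse : (a + 1, b + -1) ∈ hexPoints r := mem_hexPoints.2 (by omega)
  have hnw : (a + -1, b + 1) ∈ hexPoints r := mem_hexPoints.2 (by omega)
  simp only [sum_hexSteps, flagSum, hexRot_apply, hexRot_symm_apply, Prod.mk_add_mk, add_zero,
    zero_add, neg_zero, neg_neg, add_neg_cancel, neg_add_cancel, he, hw, hn, hs, hse, hnw, if_true]

theorem sum_flagSum_corner_northeast (hr : 2 ≤ r) (ha : a = 0) (h : a + b = r - 1) :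
    ∑ s ∈ hexSteps, flagSum r F A (a, b) s =
      (F (a, b) (a + -1, b) + A (a, b) (a + -1, b) (a, b + -1)) + (
      (F (a, b) (a, b + -1) +
        (A (a, b) (a, b + -1) (a + 1, b + -1) + A (a, b) (a, b + -1) (a + -1, b))) +
      (F (a, b) (a + 1, b + -1) + A (a, b) (a + 1, b + -1) (a, b + -1))) := by
  have he : (a + 1, b) ∉ hexPoints r := not_mem_hexPoints_of (by omega)
  have hw : (a + -1, b) ∈ hexPoints r := mem_hexPoints.2 (by omega)
  have hn : (a, b + 1) ∉ hexPoints r := not_mem_hexPoints_of (by omega)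
  have hs : (a, b + -1) ∈ hexPoints r := mem_hexPoints.2 (by omega)
  have hse : (a + 1, b + -1) ∈ hexPoints r := mem_hexPoints.2 (by omega)
  have hnw : (a + -1, b + 1) ∉ hexPoints r := not_mem_hexPoints_of (by omega)
  simp only [sum_hexSteps, flagSum, hexRot_apply, hexRot_symm_apply, Prod.mk_add_mk, add_zero,
    zero_add, neg_zero, neg_neg, add_neg_cancel, neg_add_cancel, he, hw, hn, hs, hse, hnw, if_true,
    if_false]

theorem sum_flagSum_corner_east (hr : 2 ≤ r) (hb : b = 0) (h : a + b = r - 1) :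
    ∑ s ∈ hexSteps, flagSum r F A (a, b) s =
      (F (a, b) (a + -1, b) +
        (A (a, b) (a + -1, b) (a, b + -1) + A (a, b) (a + -1, b) (a + -1, b + 1))) + (
      (F (a, b) (a, b + -1) + A (a, b) (a, b + -1) (a + -1, b)) +
      (F (a, b) (a + -1, b + 1) + A (a, b) (a + -1, b + 1) (a + -1, b))) := by
  have he : (a + 1, b) ∉ hexPoints r := not_mem_hexPoints_of (by omega)
  have hw : (a + -1, b) ∈ hexPoints r := mem_hexPoints.2 (by omega)
  have hn : (a, b + 1) ∉ hexPoints r := not_mem_hexPoints_of (by omega)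
  have hs : (a, b + -1) ∈ hexPoints r := mem_hexPoints.2 (by omega)
  have hse : (a + 1, b + -1) ∉ hexPoints r := not_mem_hexPoints_of (by omega)
  have hnw : (a + -1, b + 1) ∈ hexPoints r := mem_hexPoints.2 (by omega)
  simp only [sum_hexSteps, flagSum, hexRot_apply, hexRot_symm_apply, Prod.mk_add_mk, add_zero,
    zero_add, neg_zero, neg_neg, add_neg_cancel, neg_add_cancel, he, hw, hn, hs, hse, hnw, if_true,
    if_false]

theorem sum_flagSum_side_east (ha : 0 < a) (hb : 0 < b) (h : a + b = r - 1) :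
    ∑ s ∈ hexSteps, flagSum r F A (a, b) s =
      (F (a, b) (a + -1, b) +
        (A (a, b) (a + -1, b) (a, b + -1) + A (a, b) (a + -1, b) (a + -1, b + 1))) + (
      (F (a, b) (a, b + -1) +
        (A (a, b) (a, b + -1) (a + 1, b + -1) + A (a, b) (a, b + -1) (a + -1, b))) + (
      (F (a, b) (a + 1, b + -1) + A (a, b) (a + 1, b + -1) (a, b + -1)) +
      (F (a, b) (a + -1, b + 1) + A (a, b) (a + -1, b + 1) (a + -1, b)))) := by
  have he : (a + 1, b) ∉ hexPoints r := not_mem_hexPoints_of (by omega)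
  have hw : (a + -1, b) ∈ hexPoints r := mem_hexPoints.2 (by omega)
  have hn : (a, b + 1) ∉ hexPoints r := not_mem_hexPoints_of (by omega)
  have hs : (a, b + -1) ∈ hexPoints r := mem_hexPoints.2 (by omega)
  have hse : (a + 1, b + -1) ∈ hexPoints r := mem_hexPoints.2 (by omega)
  have hnw : (a + -1, b + 1) ∈ hexPoints r := mem_hexPoints.2 (by omega)
  simp only [sum_hexSteps, flagSum, hexRot_apply, hexRot_symm_apply, Prod.mk_add_mk, add_zero,
    zero_add, neg_zero, neg_neg, add_neg_cancel, neg_add_cancel, he, hw, hn, hs, hse, hnw, if_true,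
    if_false]

end FlagSumSector

/-- With all weights 1, a flag sum counts mesh neighbours plus two new vertices per triangle: 3 +
2·2 = 7 at a corner, 4 + 2·3 = 10 on a side, 6 + 2·6 = 18 inside. -/
theorem sum_flagSum_one {r : ℕ} (hr : 2 ≤ r) (p : ℤ × ℤ) (hp : p ∈ hexPoints r) :
    ∑ s ∈ hexSteps, flagSum r (fun _ _ => 1) (fun _ _ _ => 1) p s = hexDeg (r - 1) p := by
  induction p using hexRot_induction with
  | hrot p ih =>
    rw [sum_hexSteps_flagSum_hexRot r (fun _ _ => rfl) (fun _ _ _ => rfl), hexDeg_hexRot]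
    exact ih (hexRot_mem_hexPoints.1 hp)
  | hP a b ha hb =>
    rw [mem_hexPoints] at hp
    obtain h | h : a + b < r - 1 ∨ a + b = r - 1 := by omega
    · rw [hexDeg_interior (by omega), sum_flagSum_interior _ _ ha hb h]
      rfl
    obtain ha | ha := ha.eq_or_lt
    · rw [hexDeg_corner_northeast (by omega) (by omega) (by omega),
        sum_flagSum_corner_northeast _ _ hr ha.symm h]
      rfl
    obtain hb | hb := hb.eq_or_lt
    · rw [hexDeg_corner_east (by omega) (by omega) (by omega),
        sum_flagSum_corner_east _ _ hr hb.symm h]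
      rfl
    · rw [hexDeg_side_east h ha hb, sum_flagSum_side_east _ _ ha hb h]
      rfl

/-- Mesh neighbours are weighted by their degree and new ones by 4. For example a corner gives 10 +
10 + 18 + 4·4 = 54, and a point deep inside gives 6·18 + 12·4 = 156. -/
theorem sum_flagSum_hexDeg {r : ℕ} (hr : 5 ≤ r) (p : ℤ × ℤ) (hp : p ∈ hexPoints r) :
    ∑ s ∈ hexSteps, flagSum r (fun _ x => hexDeg (r - 1) x) (fun _ _ _ => 4) p s =
      hexDegSum (r - 1) p := by
  induction p using hexRot_induction with
  | hrot p ih =>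
    rw [sum_hexSteps_flagSum_hexRot r (fun _ _ => hexDeg_hexRot _ _) (fun _ _ _ => rfl), 
      hexDegSum_hexRot]
    exact ih (hexRot_mem_hexPoints.1 hp)
  | hP a b ha hb =>
    rw [mem_hexPoints] at hp
    obtain h | h | h : a + b < r - 2 ∨ a + b = r - 2 ∨ a + b = r - 1 := by omega
    · rw [hexDegSum_interior (by omega),
        sum_flagSum_interior _ _ (by omega) (by omega) (by omega)]
      have de : hexDeg (r - 1) (a + 1, b) = 18 := hexDeg_interior
      have dw : hexDeg (r - 1) (a + -1, b) = 18 := hexDeg_interior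
      have dn : hexDeg (r - 1) (a, b + 1) = 18 := hexDeg_interior
      have ds : hexDeg (r - 1) (a, b + -1) = 18 := hexDeg_interior
      have dse : hexDeg (r - 1) (a + 1, b + -1) = 18 := hexDeg_interior
      have dnw : hexDeg (r - 1) (a + -1, b + 1) = 18 := hexDeg_interior
      simp only [de, dw, dn, ds, dse, dnw, Nat.reduceAdd]
    · obtain ha | ha := ha.eq_or_lt
      · rw [hexDegSum_inner_corner_northeast (by omega) (by omega) (by omega),
          sum_flagSum_interior _ _ (by omega) (by omega) (by omega)]
        have de : hexDeg (r - 1) (a + 1, b) = 10 := hexDeg_side_east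
        have dw : hexDeg (r - 1) (a + -1, b) = 18 := hexDeg_interior
        have dn : hexDeg (r - 1) (a, b + 1) = 7 := hexDeg_corner_northeast
        have ds : hexDeg (r - 1) (a, b + -1) = 18 := hexDeg_interior
        have dse : hexDeg (r - 1) (a + 1, b + -1) = 18 := hexDeg_interior
        have dnw : hexDeg (r - 1) (a + -1, b + 1) = 10 := hexDeg_side_north
        simp only [de, dw, dn, ds, dse, dnw, Nat.reduceAdd]
      obtain hb | hb := hb.eq_or_lt
      · rw [hexDegSum_inner_corner_east (by omega) (by omega) (by omega),
          sum_flagSum_interior _ _ (by omega) (by omega) (by omega)]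
        have de : hexDeg (r - 1) (a + 1, b) = 7 := hexDeg_corner_east
        have dw : hexDeg (r - 1) (a + -1, b) = 18 := hexDeg_interior
        have dn : hexDeg (r - 1) (a, b + 1) = 10 := hexDeg_side_east
        have ds : hexDeg (r - 1) (a, b + -1) = 18 := hexDeg_interior
        have dse : hexDeg (r - 1) (a + 1, b + -1) = 10 := hexDeg_side_southeast
        have dnw : hexDeg (r - 1) (a + -1, b + 1) = 18 := hexDeg_interior
        simp only [de, dw, dn, ds, dse, dnw, Nat.reduceAdd]
      · rw [hexDegSum_inner_side_east (by omega) (by omega) (by omega),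
          sum_flagSum_interior _ _ (by omega) (by omega) (by omega)]
        have de : hexDeg (r - 1) (a + 1, b) = 10 := hexDeg_side_east
        have dw : hexDeg (r - 1) (a + -1, b) = 18 := hexDeg_interior
        have dn : hexDeg (r - 1) (a, b + 1) = 10 := hexDeg_side_east
        have ds : hexDeg (r - 1) (a, b + -1) = 18 := hexDeg_interior
        have dse : hexDeg (r - 1) (a + 1, b + -1) = 18 := hexDeg_interior
        have dnw : hexDeg (r - 1) (a + -1, b + 1) = 18 := hexDeg_interior
        simp only [de, dw, dn, ds, dse, dnw, Nat.reduceAdd]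
    · obtain ha | ha := ha.eq_or_lt
      · rw [hexDegSum_corner_northeast (by omega) (by omega) (by omega),
          sum_flagSum_corner_northeast _ _ (by omega) ha.symm h]
        have dw : hexDeg (r - 1) (a + -1, b) = 10 := hexDeg_side_north
        have ds : hexDeg (r - 1) (a, b + -1) = 18 := hexDeg_interior
        have dse : hexDeg (r - 1) (a + 1, b + -1) = 10 := hexDeg_side_east
        simp only [dw, ds, dse, Nat.reduceAdd]
      obtain hb | hb := hb.eq_or_lt
      · rw [hexDegSum_corner_east (by omega) (by omega) (by omega),
          sum_flagSum_corner_east _ _ (by omega) hb.symm h]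
        have dw : hexDeg (r - 1) (a + -1, b) = 18 := hexDeg_interior
        have ds : hexDeg (r - 1) (a, b + -1) = 10 := hexDeg_side_southeast
        have dnw : hexDeg (r - 1) (a + -1, b + 1) = 10 := hexDeg_side_east
        simp only [dw, ds, dnw, Nat.reduceAdd]
      obtain ha' | ha' := (show 1 ≤ a from ha).eq_or_lt
      · rw [hexDegSum_next_northeast (by omega) (by omega) (by omega),
          sum_flagSum_side_east _ _ ha hb h]
        have dw : hexDeg (r - 1) (a + -1, b) = 18 := hexDeg_interior
        have ds : hexDeg (r - 1) (a, b + -1) = 18 := hexDeg_interior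
        have dse : hexDeg (r - 1) (a + 1, b + -1) = 10 := hexDeg_side_east
        have dnw : hexDeg (r - 1) (a + -1, b + 1) = 7 := hexDeg_corner_northeast
        simp only [dw, ds, dse, dnw, Nat.reduceAdd]
      obtain hb' | hb' := (show 1 ≤ b from hb).eq_or_lt
      · rw [hexDegSum_next_east (by omega) (by omega) (by omega),
          sum_flagSum_side_east _ _ ha hb h]
        have dw : hexDeg (r - 1) (a + -1, b) = 18 := hexDeg_interior
        have ds : hexDeg (r - 1) (a, b + -1) = 18 := hexDeg_interior
        have dse : hexDeg (r - 1) (a + 1, b + -1) = 7 := hexDeg_corner_east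
        have dnw : hexDeg (r - 1) (a + -1, b + 1) = 10 := hexDeg_side_east
        simp only [dw, ds, dse, dnw, Nat.reduceAdd]
      · rw [hexDegSum_side_east (by omega) (by omega) (by omega),
          sum_flagSum_side_east _ _ ha hb h]
        have dw : hexDeg (r - 1) (a + -1, b) = 18 := hexDeg_interior
        have ds : hexDeg (r - 1) (a, b + -1) = 18 := hexDeg_interior
        have dse : hexDeg (r - 1) (a + 1, b + -1) = 10 := hexDeg_side_east
        have dnw : hexDeg (r - 1) (a + -1, b + 1) = 10 := hexDeg_side_east
        simp only [dw, ds, dse, dnw, Nat.reduceAdd]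

/-! ### Reflection and decomposition into horizontal rows. -/

/-- The reflection of the triangular lattice in the line through the origin and `(1, 0)`. -/
def hexRefl (p : ℤ × ℤ) : ℤ × ℤ := (p.1 + p.2, -p.2)

theorem hexRefl_hexRefl (p : ℤ × ℤ) : hexRefl (hexRefl p) = p := by
  simp [hexRefl]

theorem hexRefl_mem_hexPoints {r : ℕ} {p : ℤ × ℤ} : hexRefl p ∈ hexPoints r ↔ p ∈ hexPoints r := by
  obtain ⟨a, b⟩ := p
  simp only [hexRefl, mem_hexPoints]
  omega

theorem hexNorm_hexRefl (p : ℤ × ℤ) : hexNorm (hexRefl p) = hexNorm p := by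
  obtain ⟨a, b⟩ := p
  simp only [hexRefl, hexNorm]
  omega

theorem hexDeg_hexRefl (n : ℤ) (p : ℤ × ℤ) : hexDeg n (hexRefl p) = hexDeg n p := by
  have h : (hexRefl p).1 = 0 ∨ (hexRefl p).2 = 0 ∨ (hexRefl p).1 + (hexRefl p).2 = 0 ↔
      p.1 = 0 ∨ p.2 = 0 ∨ p.1 + p.2 = 0 := by
    simp only [hexRefl]
    omega
  simp only [hexDeg, hexNorm_hexRefl, h]

theorem hexDegSum_hexRefl (n : ℤ) (p : ℤ × ℤ) : hexDegSum n (hexRefl p) = hexDegSum n p := by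
  have h : (hexRefl p).1 = 0 ∨ (hexRefl p).2 = 0 ∨ (hexRefl p).1 + (hexRefl p).2 = 0 ↔
      p.1 = 0 ∨ p.2 = 0 ∨ p.1 + p.2 = 0 := by
    simp only [hexRefl]
    omega
  have h' : (hexRefl p).1 = 1 ∨ (hexRefl p).1 = -1 ∨ (hexRefl p).2 = 1 ∨ (hexRefl p).2 = -1 ∨
      (hexRefl p).1 + (hexRefl p).2 = 1 ∨ (hexRefl p).1 + (hexRefl p).2 = -1 ↔
      p.1 = 1 ∨ p.1 = -1 ∨ p.2 = 1 ∨ p.2 = -1 ∨ p.1 + p.2 = 1 ∨ p.1 + p.2 = -1 := by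
    simp only [hexRefl]
    omega
  simp only [hexDegSum, hexNorm_hexRefl, h, h']

/-- The reflection exchanges the open half-planes and fixes the axis, so doubling the closed upper
half counts the axis once too often. -/
theorem sum_hexPoints_add_sum_axis {M : Type*} [AddCommMonoid M] (r : ℕ) {f : ℤ × ℤ → M}
    (hf : ∀ p, f (hexRefl p) = f p) :
    ∑ p ∈ hexPoints r, f p + ∑ p ∈ hexPoints r with p.2 = 0, f p =
      2 • ∑ p ∈ hexPoints r with 0 ≤ p.2, f p := by
  have h1 := Finset.sum_filter_add_sum_filter_not (hexPoints r) (fun p => 0 ≤ p.2) f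
  have h2 : ∑ p ∈ hexPoints r with ¬ 0 ≤ p.2, f p = ∑ p ∈ hexPoints r with 0 < p.2, f p := by
    refine Finset.sum_bij' (fun p _ => hexRefl p) (fun p _ => hexRefl p) ?_ ?_
      (fun p _ => hexRefl_hexRefl p) (fun p _ => hexRefl_hexRefl p) fun p _ => (hf p).symm
    all_goals
      intro p hp
      rw [Finset.mem_filter] at hp ⊢
      refine ⟨hexRefl_mem_hexPoints.2 hp.1, ?_⟩
      have := hp.2
      simp only [hexRefl]
      omega
  have h3 := Finset.sum_filter_add_sum_filter_not
    ((hexPoints r).filter fun p => 0 ≤ p.2) (fun p => p.2 = 0) f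
  have h4 : (hexPoints r).filter (fun p => 0 ≤ p.2 ∧ p.2 = 0) =
      (hexPoints r).filter fun p => p.2 = 0 := Finset.filter_congr fun p _ => by omega
  have h5 : (hexPoints r).filter (fun p => 0 ≤ p.2 ∧ ¬ p.2 = 0) =
      (hexPoints r).filter fun p => 0 < p.2 := Finset.filter_congr fun p _ => by omega
  rw [Finset.filter_filter, Finset.filter_filter, h4, h5] at h3
  rw [← h1, h2, add_assoc, add_comm (∑ p ∈ hexPoints r with 0 < p.2, f p), h3, two_nsmul]

theorem sum_hexPoints_axis {M : Type*} [AddCommMonoid M] (r : ℕ) (f : ℤ × ℤ → M) :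
    ∑ p ∈ hexPoints r with p.2 = 0, f p =
      ∑ t ∈ Finset.range (2 * r - 1), f (1 - r + t, 0) := by
  symm
  refine Finset.sum_bij (fun t _ => (1 - (r : ℤ) + t, 0)) ?_ ?_ ?_ fun _ _ => rfl
  · intro t ht
    rw [Finset.mem_range] at ht
    rw [Finset.mem_filter, mem_hexPoints]
    exact ⟨by omega, rfl⟩
  · intro t _ t' _ h
    simpa using h
  · rintro ⟨a, b⟩ h
    rw [Finset.mem_filter, mem_hexPoints] at h
    obtain ⟨h, rfl : b = 0⟩ := h
    refine ⟨(a + r - 1).toNat, ?_, ?_⟩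
    · rw [Finset.mem_range]
      omega
    · rw [Prod.mk.injEq]
      omega

theorem sum_hexPoints_upper {M : Type*} [AddCommMonoid M] (r : ℕ) (f : ℤ × ℤ → M) :
    ∑ p ∈ hexPoints r with 0 ≤ p.2, f p =
      ∑ m ∈ Finset.range r, ∑ t ∈ Finset.range (2 * r - 1 - m), f (1 - r + t, m) := by
  rw [Finset.sum_sigma']
  symm
  refine Finset.sum_bij (fun q _ => (1 - (r : ℤ) + q.2, (q.1 : ℤ))) ?_ ?_ ?_ fun _ _ => rfl
  · rintro ⟨m, t⟩ h
    simp only [Finset.mem_sigma, Finset.mem_range] at h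
    rw [Finset.mem_filter, mem_hexPoints]
    refine ⟨?_, ?_⟩ <;> dsimp only <;> omega
  · rintro ⟨m, t⟩ _ ⟨m', t'⟩ _ h
    simp only [Prod.mk.injEq, add_right_inj, Nat.cast_inj] at h
    rw [h.1, h.2]
  · rintro ⟨a, b⟩ h
    rw [Finset.mem_filter, mem_hexPoints] at h
    obtain ⟨h, hb⟩ := h
    dsimp only at hb
    refine ⟨⟨b.toNat, (a + r - 1).toNat⟩, ?_, ?_⟩
    · simp only [Finset.mem_sigma, Finset.mem_range]
      omega
    · rw [Prod.mk.injEq]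
      dsimp only
      omega

/-- Used at two levels: for the edges of one row and for the rows of the upper half. Both have two
exceptional terms at each end. -/
theorem sum_range_eq_ends_add_sum {n : ℕ} (hn : 4 ≤ n) (f : ℕ → ℝ) :
    ∑ t ∈ Finset.range n, f t =
      f 0 + f 1 + ∑ t ∈ Finset.range (n - 4), f (t + 2) + f (n - 2) + f (n - 1) := by
  obtain ⟨k, rfl⟩ := Nat.exists_eq_add_of_le' hn
  rw [Finset.sum_range_succ, Finset.sum_range_succ, Finset.sum_range_succ', Finset.sum_range_succ',
    add_comm (f 0) (f 1), add_comm (f 1 + f 0), ← add_assoc]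
  rfl

theorem sum_range_eq_ends_add {n : ℕ} (hn : 4 ≤ n) {f : ℕ → ℝ} {C : ℝ}
    (hC : ∀ t, 2 ≤ t → t + 2 < n → f t = C) :
    ∑ t ∈ Finset.range n, f t =
      f 0 + f 1 + ((n : ℝ) - 4) * C + f (n - 2) + f (n - 1) := by
  rw [sum_range_eq_ends_add_sum hn, Finset.sum_congr rfl fun t ht => hC (t + 2) (by omega)
    (by rw [Finset.mem_range] at ht; omega), Finset.sum_const, Finset.card_range, nsmul_eq_mul,
    Nat.cast_sub hn, Nat.cast_ofNat]

/-! ### East-pointing flags, summed row by row. -/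

/-- The contribution of the edge from `p` to `p + (1, 0)` and of the two triangles at this edge to
an edge sum over the hex derived network. -/
noncomputable def eastFlag (g : ℕ → ℕ → ℝ) (r : ℕ) (p : ℤ × ℤ) : ℝ :=
  flagSum r (fun u x => g (hexDegSum (r - 1) u) (hexDegSum (r - 1) x))
    (fun u x y => 2 * g (hexDegSum (r - 1) u) (8 + (hexDeg (r - 1) u + hexDeg (r - 1) y)) +
      g (8 + (hexDeg (r - 1) x + hexDeg (r - 1) y)) (8 + (hexDeg (r - 1) u + hexDeg (r - 1) y)))
    p (1, 0)

section EastFlag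

variable {g : ℕ → ℕ → ℝ} {r : ℕ}

theorem eastFlag_eq_ite (a b : ℤ) : eastFlag g r (a, b) =
    if (a + 1, b) ∈ hexPoints r then
      g (hexDegSum (r - 1) (a, b)) (hexDegSum (r - 1) (a + 1, b)) +
      ((if (a, b + 1) ∈ hexPoints r then
        2 * g (hexDegSum (r - 1) (a, b)) (8 + (hexDeg (r - 1) (a, b) + hexDeg (r - 1) (a, b + 1))) +
        g (8 + (hexDeg (r - 1) (a + 1, b) + hexDeg (r - 1) (a, b + 1)))
          (8 + (hexDeg (r - 1) (a, b) + hexDeg (r - 1) (a, b + 1))) else 0) +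
      if (a + 1, b + -1) ∈ hexPoints r then
        2 * g (hexDegSum (r - 1) (a, b))
          (8 + (hexDeg (r - 1) (a, b) + hexDeg (r - 1) (a + 1, b + -1))) +
        g (8 + (hexDeg (r - 1) (a + 1, b) + hexDeg (r - 1) (a + 1, b + -1)))
          (8 + (hexDeg (r - 1) (a, b) + hexDeg (r - 1) (a + 1, b + -1))) else 0)
    else 0 := by
  simp only [eastFlag, flagSum, hexRot_apply, hexRot_symm_apply, Prod.mk_add_mk, add_zero, neg_zero]

/-- The reflection fixes the step `(1, 0)` and swaps the triangles above and below the edge, hence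
the final `add_comm`. -/
theorem eastFlag_hexRefl (p : ℤ × ℤ) : eastFlag g r (hexRefl p) = eastFlag g r p := by
  obtain ⟨a, b⟩ := p
  have e1 : (a + b + 1, -b) = hexRefl (a + 1, b) := by
    simp only [hexRefl, Prod.mk.injEq, and_true]
    ring
  have e2 : (a + b, -b + 1) = hexRefl (a + 1, b + -1) := by
    simp only [hexRefl, Prod.mk.injEq]
    constructor <;> ring
  have e3 : (a + b + 1, -b + -1) = hexRefl (a, b + 1) := by
    simp only [hexRefl, Prod.mk.injEq]
    constructor <;> ring
  have e0 : (a + b, -b) = hexRefl (a, b) := rfl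
  rw [← e0, eastFlag_eq_ite, eastFlag_eq_ite, e0, e1, e2, e3]
  simp only [hexRefl_mem_hexPoints, hexDeg_hexRefl, hexDegSum_hexRefl]
  congr 2
  exact add_comm _ _

/-- The numbers `s`, `s'`, `d`, `d'`, `e`, `e'` are found by unification with the closed-form lemmas
passed as `h1` to `h6`. -/
theorem eastFlag_of_mem {a b : ℤ} {s s' d d' e e' : ℕ}
    (h1 : hexDegSum (r - 1) (a, b) = s) (h2 : hexDegSum (r - 1) (a + 1, b) = s')
    (h3 : hexDeg (r - 1) (a, b) = d) (h4 : hexDeg (r - 1) (a + 1, b) = d')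
    (h5 : hexDeg (r - 1) (a, b + 1) = e) (h6 : hexDeg (r - 1) (a + 1, b + -1) = e')
    (h : (a + 1, b) ∈ hexPoints r := by exact mem_hexPoints.2 (by omega))
    (hn : (a, b + 1) ∈ hexPoints r := by exact mem_hexPoints.2 (by omega))
    (hs : (a + 1, b + -1) ∈ hexPoints r := by exact mem_hexPoints.2 (by omega)) :
    eastFlag g r (a, b) = g s s' + ((2 * g s (8 + (d + e)) + g (8 + (d' + e)) (8 + (d + e))) +
      (2 * g s (8 + (d + e')) + g (8 + (d' + e')) (8 + (d + e')))) := by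
  rw [eastFlag_eq_ite, if_pos h, if_pos hn, if_pos hs, h1, h2, h3, h4, h5, h6]

/-- The case of the top row, whose edges have no triangle above them. -/
theorem eastFlag_of_mem_of_not_mem {a b : ℤ} {s s' d d' e' : ℕ}
    (h1 : hexDegSum (r - 1) (a, b) = s) (h2 : hexDegSum (r - 1) (a + 1, b) = s')
    (h3 : hexDeg (r - 1) (a, b) = d) (h4 : hexDeg (r - 1) (a + 1, b) = d')
    (h6 : hexDeg (r - 1) (a + 1, b + -1) = e')
    (h : (a + 1, b) ∈ hexPoints r := by exact mem_hexPoints.2 (by omega))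
    (hn : (a, b + 1) ∉ hexPoints r := by exact not_mem_hexPoints_of (by omega))
    (hs : (a + 1, b + -1) ∈ hexPoints r := by exact mem_hexPoints.2 (by omega)) :
    eastFlag g r (a, b) =
      g s s' + (2 * g s (8 + (d + e')) + g (8 + (d' + e')) (8 + (d + e'))) := by
  rw [eastFlag_eq_ite, if_pos h, if_neg hn, if_pos hs, h1, h2, h3, h4, h6, zero_add]

theorem eastFlag_of_not_mem {a b : ℤ} (h : (a + 1, b) ∉ hexPoints r) :
    eastFlag g r (a, b) = 0 := by
  rw [eastFlag_eq_ite, if_neg h]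

/-- The last point of a row has no neighbour to the east. -/
theorem sum_eastFlag_row {m : ℕ} (hm : m < r) :
    ∑ t ∈ Finset.range (2 * r - 1 - m), eastFlag g r (1 - r + t, m) =
      ∑ t ∈ Finset.range (2 * r - 2 - m), eastFlag g r (1 - r + t, m) := by
  rw [show 2 * r - 1 - m = 2 * r - 2 - m + 1 by omega, Finset.sum_range_succ,
    eastFlag_of_not_mem (not_mem_hexPoints_of (by omega)), add_zero]

theorem sum_eastFlag_row_zero (hg : ∀ a b, g a b = g b a) (hr : 5 ≤ r) :
    ∑ t ∈ Finset.range (2 * r - 2), eastFlag g r (1 - r + t, 0) =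
      4 * g 25 36 + 4 * g 25 54 + 4 * g 36 129 + 4 * g 44 44 + 4 * g 44 129 + 4 * g 44 156 +
      2 * g 54 129 + 2 * g 129 156 + (2 * r - 6 : ℝ) * (2 * g 44 44 + 4 * g 44 156 +
      g 156 156) := by
  have h0 :=
    eastFlag_of_mem (g := g) (r := r) (a := 1 - r + ((0 : ℕ) : ℤ)) (b := 0) hexDegSum_corner_west
      hexDegSum_inner_corner_west hexDeg_corner_west hexDeg_interior hexDeg_side_west
      hexDeg_side_southwest
  have h1 :=
    eastFlag_of_mem (g := g) (r := r) (a := 1 - r + ((1 : ℕ) : ℤ)) (b := 0)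
      hexDegSum_inner_corner_west hexDegSum_interior hexDeg_interior hexDeg_interior
      hexDeg_interior hexDeg_interior
  have hC (t : ℕ) (ht : 2 ≤ t) (ht' : t + 2 < 2 * r - 2) :=
    eastFlag_of_mem (g := g) (r := r) (a := 1 - r + (t : ℤ)) (b := 0) hexDegSum_interior
      hexDegSum_interior hexDeg_interior hexDeg_interior hexDeg_interior hexDeg_interior
  have h3 :=
    eastFlag_of_mem (g := g) (r := r) (a := 1 - r + ((2 * r - 2 - 2 : ℕ) : ℤ)) (b := 0)
      hexDegSum_interior hexDegSum_inner_corner_east hexDeg_interior hexDeg_interior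
      hexDeg_interior hexDeg_interior
  have h4 :=
    eastFlag_of_mem (g := g) (r := r) (a := 1 - r + ((2 * r - 2 - 1 : ℕ) : ℤ)) (b := 0)
      hexDegSum_inner_corner_east hexDegSum_corner_east hexDeg_interior hexDeg_corner_east
      hexDeg_side_east hexDeg_side_southeast
  rw [sum_range_eq_ends_add (by omega) hC, h0, h1, h3, h4]
  simp only [Nat.reduceAdd, hg 129 36, hg 129 44, hg 129 54, hg 156 129, hg 156 44, hg 36 25,
    hg 54 25]
  rw [Nat.cast_sub (by omega)]
  push_cast
  ring

/-- The parameter `s` is the neighbourhood sum at both ends of the row: 77 for `m = 1`, where the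
ends are next to corners, and 80 for the rows from 2 to `r - 3`. -/
theorem sum_eastFlag_row_lower (hg : ∀ a b, g a b = g b a) (hr : 5 ≤ r)
    {m s : ℕ} (h1 : 1 ≤ m) (hm : m + 3 ≤ r)
    (h : hexDegSum (r - 1) (1 - r + ((0 : ℕ) : ℤ), m) = s)
    (h' : hexDegSum (r - 1) (1 - r + ((2 * r - 2 - m - 1 : ℕ) : ℤ) + 1, m) = s) :
    ∑ t ∈ Finset.range (2 * r - 2 - m), eastFlag g r (1 - r + t, m) =
      2 * g 28 36 + 2 * g 28 s + 2 * g 36 44 + 2 * g 36 140 + 2 * g 36 s + 4 * g 44 44 +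
      6 * g 44 140 + 4 * g 44 156 + 2 * g 140 156 + 2 * g 140 s +
      (2 * r - 6 - m : ℝ) * (2 * g 44 44 + 4 * g 44 156 + g 156 156) := by
  have h0 :=
    eastFlag_of_mem (g := g) (r := r) (a := 1 - r + ((0 : ℕ) : ℤ)) (b := (m : ℤ)) h
      hexDegSum_inner_side_west hexDeg_side_west hexDeg_interior hexDeg_side_west hexDeg_interior
  have h1 :=
    eastFlag_of_mem (g := g) (r := r) (a := 1 - r + ((1 : ℕ) : ℤ)) (b := (m : ℤ))
      hexDegSum_inner_side_west hexDegSum_interior hexDeg_interior hexDeg_interior hexDeg_interior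
      hexDeg_interior
  have hC (t : ℕ) (ht : 2 ≤ t) (ht' : t + 2 < 2 * r - 2 - m) :=
    eastFlag_of_mem (g := g) (r := r) (a := 1 - r + (t : ℤ)) (b := (m : ℤ)) hexDegSum_interior
      hexDegSum_interior hexDeg_interior hexDeg_interior hexDeg_interior hexDeg_interior
  have h3 :=
    eastFlag_of_mem (g := g) (r := r) (a := 1 - r + ((2 * r - 2 - m - 2 : ℕ) : ℤ)) (b := (m : ℤ))
      hexDegSum_interior hexDegSum_inner_side_east hexDeg_interior hexDeg_interior hexDeg_interior
      hexDeg_interior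
  have h4 :=
    eastFlag_of_mem (g := g) (r := r) (a := 1 - r + ((2 * r - 2 - m - 1 : ℕ) : ℤ)) (b := (m : ℤ))
      hexDegSum_inner_side_east h' hexDeg_interior hexDeg_side_east hexDeg_side_east
      hexDeg_interior
  rw [sum_range_eq_ends_add (by omega) hC, h0, h1, h3, h4]
  simp only [Nat.reduceAdd, hg s 140, hg s 28, hg s 36, hg 140 36, hg 140 44, hg 156 140,
    hg 156 44, hg 36 28, hg 44 36]
  rw [Nat.cast_sub (by omega), Nat.cast_sub (by omega)]
  push_cast
  ring

theorem sum_eastFlag_row_inner (hg : ∀ a b, g a b = g b a) (hr : 5 ≤ r)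
    {m : ℕ} (hm : m + 2 = r) :
    ∑ t ∈ Finset.range (2 * r - 2 - m), eastFlag g r (1 - r + t, m) =
      2 * g 25 33 + 2 * g 25 77 + 2 * g 33 129 + 2 * g 36 36 + 2 * g 36 44 + 2 * g 36 77 +
      2 * g 36 129 + 2 * g 36 140 + 2 * g 44 44 + 4 * g 44 129 + 2 * g 44 140 + 2 * g 77 129 +
      2 * g 129 140 + (r - 4 : ℝ) * (g 36 36 + 2 * g 36 140 + g 44 44 + 2 * g 44 140 +
      g 140 140) := by
  have h0 :=
    eastFlag_of_mem (g := g) (r := r) (a := 1 - r + ((0 : ℕ) : ℤ)) (b := (m : ℤ))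
      hexDegSum_next_west hexDegSum_inner_corner_northwest hexDeg_side_west hexDeg_interior
      hexDeg_corner_northwest hexDeg_interior
  have h1 :=
    eastFlag_of_mem (g := g) (r := r) (a := 1 - r + ((1 : ℕ) : ℤ)) (b := (m : ℤ))
      hexDegSum_inner_corner_northwest hexDegSum_inner_side_north hexDeg_interior hexDeg_interior
      hexDeg_side_north hexDeg_interior
  have hC (t : ℕ) (ht : 2 ≤ t) (ht' : t + 2 < 2 * r - 2 - m) :=
    eastFlag_of_mem (g := g) (r := r) (a := 1 - r + (t : ℤ)) (b := (m : ℤ))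
      hexDegSum_inner_side_north hexDegSum_inner_side_north hexDeg_interior hexDeg_interior
      hexDeg_side_north hexDeg_interior
  have h3 :=
    eastFlag_of_mem (g := g) (r := r) (a := 1 - r + ((2 * r - 2 - m - 2 : ℕ) : ℤ)) (b := (m : ℤ))
      hexDegSum_inner_side_north hexDegSum_inner_corner_northeast hexDeg_interior hexDeg_interior
      hexDeg_side_north hexDeg_interior
  have h4 :=
    eastFlag_of_mem (g := g) (r := r) (a := 1 - r + ((2 * r - 2 - m - 1 : ℕ) : ℤ)) (b := (m : ℤ))
      hexDegSum_inner_corner_northeast hexDegSum_next_northeast hexDeg_interior hexDeg_side_east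
      hexDeg_corner_northeast hexDeg_interior
  rw [sum_range_eq_ends_add (by omega) hC, h0, h1, h3, h4]
  simp only [Nat.reduceAdd, hg 129 33, hg 129 36, hg 129 44, hg 129 77, hg 140 129, hg 140 36,
    hg 140 44, hg 33 25, hg 44 36, hg 77 25, hg 77 36]
  rw [show 2 * r - 2 - m = r by omega]
  ring

theorem sum_eastFlag_row_outer (hg : ∀ a b, g a b = g b a) (hr : 5 ≤ r)
    {m : ℕ} (hm : m + 1 = r) :
    ∑ t ∈ Finset.range (2 * r - 2 - m), eastFlag g r (1 - r + t, m) =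
      2 * g 33 36 + 2 * g 33 54 + 2 * g 36 36 + 4 * g 36 77 + 2 * g 36 80 + 2 * g 54 77 +
      2 * g 77 80 + (r - 5 : ℝ) * (g 36 36 + 2 * g 36 80 + g 80 80) := by
  have h0 :=
    eastFlag_of_mem_of_not_mem (g := g) (r := r) (a := 1 - r + ((0 : ℕ) : ℤ)) (b := (m : ℤ))
      hexDegSum_corner_northwest hexDegSum_next_northwest hexDeg_corner_northwest
      hexDeg_side_north hexDeg_interior
  have h1 :=
    eastFlag_of_mem_of_not_mem (g := g) (r := r) (a := 1 - r + ((1 : ℕ) : ℤ)) (b := (m : ℤ))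
      hexDegSum_next_northwest hexDegSum_side_north hexDeg_side_north hexDeg_side_north
      hexDeg_interior
  have hC (t : ℕ) (ht : 2 ≤ t) (ht' : t + 2 < 2 * r - 2 - m) :=
    eastFlag_of_mem_of_not_mem (g := g) (r := r) (a := 1 - r + (t : ℤ)) (b := (m : ℤ))
      hexDegSum_side_north hexDegSum_side_north hexDeg_side_north hexDeg_side_north
      hexDeg_interior
  have h3 :=
    eastFlag_of_mem_of_not_mem (g := g) (r := r) (a := 1 - r + ((2 * r - 2 - m - 2 : ℕ) : ℤ))
      (b := (m : ℤ)) hexDegSum_side_north hexDegSum_next_north hexDeg_side_north hexDeg_side_north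
      hexDeg_interior
  have h4 :=
    eastFlag_of_mem_of_not_mem (g := g) (r := r) (a := 1 - r + ((2 * r - 2 - m - 1 : ℕ) : ℤ))
      (b := (m : ℤ)) hexDegSum_next_north hexDegSum_corner_northeast hexDeg_side_north
      hexDeg_corner_northeast hexDeg_interior
  rw [sum_range_eq_ends_add (by omega) hC, h0, h1, h3, h4]
  simp only [Nat.reduceAdd, hg 36 33, hg 54 33, hg 77 36, hg 77 54, hg 80 36, hg 80 77]
  -- The top row is the shortest, with `r - 1` edges; its four exceptional edges are what requires
  -- `5 ≤ r`.
  rw [show 2 * r - 2 - m = r - 1 by omega]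
  rw [Nat.cast_sub (by omega)]
  push_cast
  ring

end EastFlag

/-! ### Assembly of the rows and the partition into classes. -/

theorem sum_range_add_mul (k : ℕ) (A B C : ℝ) :
    ∑ m ∈ Finset.range k, (A + (B - (m + 2 : ℕ)) * C) = k * A + (k * B - k * (k + 3) / 2) * C := by
  induction k with
  | zero => simp
  | succ k ih =>
    rw [Finset.sum_range_succ, ih]
    push_cast
    ring

theorem sum_hexPoints_eastFlag (g : ℕ → ℕ → ℝ) {r : ℕ} (hr : 1 ≤ r) :
    ∑ p ∈ hexPoints r, eastFlag g r p =
      2 * (∑ m ∈ Finset.range r, ∑ t ∈ Finset.range (2 * r - 2 - m), eastFlag g r (1 - r + t, m)) -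
        ∑ t ∈ Finset.range (2 * r - 2), eastFlag g r (1 - r + t, 0) := by
  have h1 := sum_hexPoints_add_sum_axis r (f := eastFlag g r) eastFlag_hexRefl
  rw [sum_hexPoints_axis, sum_hexPoints_upper, nsmul_eq_mul,
    Finset.sum_congr rfl fun m hm => sum_eastFlag_row (Finset.mem_range.1 hm)] at h1
  have h2 := sum_eastFlag_row (g := g) (r := r) (m := 0) hr
  simp only [Nat.sub_zero, Nat.cast_zero] at h2
  rw [h2] at h1
  push_cast at h1
  linarith

/-- The factor 3 is 6 from the rotations divided by 2 from counting each edge in both directions. -/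
theorem sum_edgeFinset_HDN3_eq_sum_eastFlag {g : ℕ → ℕ → ℝ} (hg : ∀ a b, g a b = g b a) {r : ℕ}
    (hr : 5 ≤ r) :
    ∑ e ∈ (HDN3 r).edgeFinset, Sym2.lift ⟨fun x y =>
      g (nbrDegSum (HDN3 r) x) (nbrDegSum (HDN3 r) y), fun _ _ => hg _ _⟩ e =
    3 * ∑ p ∈ hexPoints r, eastFlag g r p := by
  have hd (u : {p : ℤ × ℤ // p ∈ hexPoints r}) :
      (HDN3 r).degree (Sum.inl u) = hexDeg (r - 1) u.1 := by
    rw [degree_octaReplace_inl, sum_hexMesh_flags u (fun _ _ => 1) (fun _ _ _ => 1),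
      sum_flagSum_one (by omega) u.1 u.2]
  have hS (u : {p : ℤ × ℤ // p ∈ hexPoints r}) :
      nbrDegSum (HDN3 r) (Sum.inl u) = hexDegSum (r - 1) u.1 := by
    rw [nbrDegSum_octaReplace_inl]
    simp_rw [hd]
    rw [sum_hexMesh_flags u (fun _ x => hexDeg (r - 1) x) (fun _ _ _ => 4),
      sum_flagSum_hexDeg hr u.1 u.2]
  have h1 := two_mul_sum_edgeFinset_octaReplace (hexMesh r) hg hd hS
  simp_rw [sum_hexMesh_flags _ (fun u x => g (hexDegSum (r - 1) u) (hexDegSum (r - 1) x))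
    (fun u x y => 2 * g (hexDegSum (r - 1) u) (8 + (hexDeg (r - 1) u + hexDeg (r - 1) y)) +
      g (8 + (hexDeg (r - 1) x + hexDeg (r - 1) y)) (8 + (hexDeg (r - 1) u + hexDeg (r - 1) y)))]
    at h1
  rw [Finset.sum_coe_sort (hexPoints r) (fun p => ∑ s ∈ hexSteps, flagSum r
    (fun u x => g (hexDegSum (r - 1) u) (hexDegSum (r - 1) x))
    (fun u x y => 2 * g (hexDegSum (r - 1) u) (8 + (hexDeg (r - 1) u + hexDeg (r - 1) y)) +
      g (8 + (hexDeg (r - 1) x + hexDeg (r - 1) y)) (8 + (hexDeg (r - 1) u + hexDeg (r - 1) y)))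
      p s), sum_hexPoints_flagSum r (by simp only [hexDegSum_hexRot, implies_true])
      (by simp only [hexDegSum_hexRot, hexDeg_hexRot, implies_true]), nsmul_eq_mul] at h1
  push_cast at h1
  change _ = 6 * ∑ p ∈ hexPoints r, eastFlag g r p at h1
  linarith

theorem sum_edgeFinset_HDN3 {g : ℕ → ℕ → ℝ} (hg : ∀ a b, g a b = g b a) {r : ℕ} (hr : 5 ≤ r) :
    ∑ e ∈ (HDN3 r).edgeFinset, Sym2.lift ⟨fun x y =>
      g (nbrDegSum (HDN3 r) x) (nbrDegSum (HDN3 r) y), fun _ _ => hg _ _⟩ e =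
    ((hdn3Classes r).map fun c => (c.2 : ℝ) * g c.1.1 c.1.2).sum := by
  -- The `r - 4` generic rows are those at height `m + 2`; the shift matches
  -- `sum_range_eq_ends_add_sum`.
  have hmid := Finset.sum_congr (rfl : Finset.range (r - 4) = Finset.range (r - 4)) fun m hm =>
    have hm : m + 2 + 3 ≤ r := by
      rw [Finset.mem_range] at hm
      omega
    sum_eastFlag_row_lower (g := g) hg hr (by omega) hm hexDegSum_side_west hexDegSum_side_east
  rw [sum_range_add_mul] at hmid
  have h0 := sum_eastFlag_row_zero hg hr
  have h1 := sum_eastFlag_row_lower (g := g) hg hr (m := 1) (by omega) (by omega)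
    hexDegSum_next_southwest hexDegSum_next_east
  have hi := sum_eastFlag_row_inner hg hr (m := r - 2) (by omega)
  have ho := sum_eastFlag_row_outer hg hr (m := r - 1) (by omega)
  rw [sum_edgeFinset_HDN3_eq_sum_eastFlag hg hr, sum_hexPoints_eastFlag g (by omega),
    sum_range_eq_ends_add_sum (by omega), hmid, hi, ho]
  simp only [Nat.sub_zero, Nat.cast_zero, Nat.cast_one] at h1 ⊢
  rw [h0, h1, Nat.cast_sub (show 4 ≤ r by omega)]
  simp only [hdn3Classes, List.map_cons, List.map_nil, List.sum_cons, List.sum_nil]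
  push_cast
  -- The row formula with general `s` produces `g 140 s`, whereas the table lists the smaller sum
  -- first.
  rw [hg 140 77, hg 140 80]
  ring

theorem sum_edgeFinset_HDN3_sym2 (φ : Sym2 ℕ → ℝ) {r : ℕ} (hr : 5 ≤ r) :
    ∑ e ∈ (HDN3 r).edgeFinset, φ (e.map (nbrDegSum (HDN3 r))) =
      ((hdn3Classes r).map fun c => (c.2 : ℝ) * φ s(c.1.1, c.1.2)).sum := by
  rw [← sum_edgeFinset_HDN3 (g := fun a b => φ s(a, b)) (fun a b => by rw [Sym2.eq_swap]) hr]
  refine Finset.sum_congr rfl fun e _ => ?_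
  induction e using Sym2.ind
  rfl

theorem nodup_map_hdn3Classes (r : ℤ) :
    ((hdn3Classes r).map fun c => s(c.1.1, c.1.2)).Nodup := by
  -- The class sizes contain the variable `r`; dropping them leaves a closed statement for `decide`.
  change (List.map (fun p : ℕ × ℕ => s(p.1, p.2)) 
    [(25, 33), (25, 36), (25, 54), (25, 77), (28, 36), (28, 77), (28, 80), (33, 36),
    (33, 54), (33, 129), (36, 36), (36, 44), (36, 77), (36, 80), (36, 129), (36, 140),
    (44, 44), (44, 129), (44, 140), (44, 156), (54, 77), (54, 129), (77, 80), (77, 129),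
    (77, 140), (80, 80), (80, 140), (129, 140), (129, 156), (140, 140), (140, 156),
    (156, 156)]).Nodup
  decide

theorem List.sum_map_mul_ite_of_nodup {ι κ : Type*} [DecidableEq κ] {l : List ι} {k : ι → κ}
    (w : ι → ℝ) (hl : (l.map k).Nodup) {c : ι} (hc : c ∈ l) :
    (l.map fun x => w x * if k x = k c then 1 else 0).sum = w c := by
  induction l with
  | nil => simp at hc
  | cons a l ih =>
    rw [List.map_cons, List.nodup_cons] at hl
    rw [List.map_cons, List.sum_cons]
    rcases List.mem_cons.1 hc with rfl | hc
    · have h0 : (l.map fun x => w x * if k x = k c then 1 else 0) = l.map fun _ => 0 := by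
        refine List.map_congr_left fun x hx => ?_
        rw [if_neg fun h : k x = k c => hl.1 (h ▸ List.mem_map_of_mem hx), mul_zero]
      rw [h0, if_pos rfl, mul_one, List.map_const', List.sum_replicate, nsmul_zero, add_zero]
    · rw [ih hl.2 hc, if_neg fun h : k a = k c => hl.1 (h ▸ List.mem_map_of_mem hc), mul_zero,
        zero_add]

/-- The edge sum identity is applied to the indicator of the class; distinctness of the 32 pairs
leaves a single term. -/
theorem card_edgeClass_HDN3 {r : ℕ} (hr : 5 ≤ r) {c : (ℕ × ℕ) × ℤ} (hc : c ∈ hdn3Classes r) :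
    ((edgeClass (HDN3 r) c.1.1 c.1.2).card : ℤ) = c.2 := by
  have h1 := sum_edgeFinset_HDN3_sym2 (fun z => if z = s(c.1.1, c.1.2) then 1 else 0) hr
  rw [List.sum_map_mul_ite_of_nodup (k := fun x : (ℕ × ℕ) × ℤ => s(x.1.1, x.1.2))
    (fun x => (x.2 : ℝ)) (nodup_map_hdn3Classes r) hc, Finset.sum_boole] at h1
  exact_mod_cast h1

/-- The test function is 0 on the listed pairs and 1 elsewhere. Its sum over the edges vanishes and
its terms are nonnegative, so each of them is 0. -/
theorem exists_mem_edgeClass_HDN3 {r : ℕ} (hr : 5 ≤ r) {e} (he : e ∈ (HDN3 r).edgeFinset) :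
    ∃ c ∈ hdn3Classes r, e ∈ edgeClass (HDN3 r) c.1.1 c.1.2 := by
  have h1 := sum_edgeFinset_HDN3_sym2
    (fun z => if z ∈ (hdn3Classes r).map (fun c => s(c.1.1, c.1.2)) then 0 else 1) hr
  have h2 : ((hdn3Classes r).map fun c => (c.2 : ℝ) *
      if s(c.1.1, c.1.2) ∈ (hdn3Classes r).map (fun c => s(c.1.1, c.1.2)) then 0 else 1) =
      (hdn3Classes r).map fun _ => 0 :=
    List.map_congr_left fun c hc => by
      rw [if_pos (List.mem_map_of_mem (f := fun c : (ℕ × ℕ) × ℤ => s(c.1.1, c.1.2)) hc), mul_zero]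
  rw [h2, List.map_const', List.sum_replicate, nsmul_zero,
    Finset.sum_eq_zero_iff_of_nonneg fun _ _ => by split_ifs <;> norm_num] at h1
  have h3 := h1 e he
  have h4 : e.map (nbrDegSum (HDN3 r)) ∈ (hdn3Classes r).map fun c => s(c.1.1, c.1.2) := by
    by_contra h
    rw [if_neg h] at h3
    exact one_ne_zero h3
  obtain ⟨c, hc, h5⟩ := List.mem_map.1 h4
  exact ⟨c, hc, Finset.mem_filter.2 ⟨he, h5.symm⟩⟩

/-! ### Numerical constants and the two closed formulas. -/

theorem Real.sqrt_eq_mul_sqrt {x c y : ℝ} (hc : 0 ≤ c) (h : x = c ^ 2 * y) : √x = c * √y := by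
  rw [h, Real.sqrt_mul (sq_nonneg c), Real.sqrt_sq hc]

theorem Real.sqrt_mem_Icc_of_sq {x a b : ℝ} (hb : 0 ≤ b) (h1 : a ^ 2 ≤ x)
    (h2 : x ≤ b ^ 2) : a ≤ √x ∧ √x ≤ b :=
  ⟨Real.le_sqrt_of_sq_le h1, (Real.sqrt_le_left hb).2 h2⟩

/-- The constant term of the fourth atom-bond connectivity index of the hex derived networks. -/
noncomputable def abcConst : ℝ :=
  12 * √(((25 : ℝ) + 33 - 2) / (25 * 33)) + 12 * √(((25 : ℝ) + 36 - 2) / (25 * 36)) +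
  12 * √(((25 : ℝ) + 54 - 2) / (25 * 54)) + 12 * √(((25 : ℝ) + 77 - 2) / (25 * 77)) +
  12 * √(((28 : ℝ) + 77 - 2) / (28 * 77)) + 12 * √(((33 : ℝ) + 36 - 2) / (33 * 36)) +
  12 * √(((33 : ℝ) + 54 - 2) / (33 * 54)) + 12 * √(((33 : ℝ) + 129 - 2) / (33 * 129)) +
  48 * √(((36 : ℝ) + 77 - 2) / (36 * 77)) + 24 * √(((36 : ℝ) + 129 - 2) / (36 * 129)) +
  36 * √(((44 : ℝ) + 129 - 2) / (44 * 129)) + 12 * √(((54 : ℝ) + 77 - 2) / (54 * 77)) +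
  6 * √(((54 : ℝ) + 129 - 2) / (54 * 129)) + 12 * √(((77 : ℝ) + 80 - 2) / (77 * 80)) +
  12 * √(((77 : ℝ) + 129 - 2) / (77 * 129)) + 12 * √(((77 : ℝ) + 140 - 2) / (77 * 140)) +
  12 * √(((129 : ℝ) + 140 - 2) / (129 * 140)) + 6 * √(((129 : ℝ) + 156 - 2) / (129 * 156))

/-- The constant term of the fifth geometric-arithmetic index of the hex derived networks. -/
noncomputable def gaConst : ℝ :=
  60 + 12 * (2 * √((25 : ℝ) * 33) / (25 + 33)) + 12 * (2 * √((25 : ℝ) * 36) / (25 + 36)) +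
  12 * (2 * √((25 : ℝ) * 54) / (25 + 54)) + 12 * (2 * √((25 : ℝ) * 77) / (25 + 77)) +
  12 * (2 * √((28 : ℝ) * 77) / (28 + 77)) + 12 * (2 * √((33 : ℝ) * 36) / (33 + 36)) +
  12 * (2 * √((33 : ℝ) * 54) / (33 + 54)) + 12 * (2 * √((33 : ℝ) * 129) / (33 + 129)) +
  48 * (2 * √((36 : ℝ) * 77) / (36 + 77)) + 24 * (2 * √((36 : ℝ) * 129) / (36 + 129)) +
  36 * (2 * √((44 : ℝ) * 129) / (44 + 129)) + 12 * (2 * √((54 : ℝ) * 77) / (54 + 77)) +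
  6 * (2 * √((54 : ℝ) * 129) / (54 + 129)) + 12 * (2 * √((77 : ℝ) * 80) / (77 + 80)) +
  12 * (2 * √((77 : ℝ) * 129) / (77 + 129)) + 12 * (2 * √((77 : ℝ) * 140) / (77 + 140)) +
  12 * (2 * √((129 : ℝ) * 140) / (129 + 140)) + 6 * (2 * √((129 : ℝ) * 156) / (129 + 156))

theorem abs_abcConst_sub_le : |abcConst - 53.139| ≤ 0.0005 := by
  -- Each root is enclosed in an interval of length 10⁻⁷. The weights in `abcConst` add up to 276,
  -- so the constant is known to within 3·10⁻⁵.
  have h0 : (521071 / 2000000 : ℝ) ≤ √(((25 : ℝ) + 33 - 2) / (25 * 33)) ∧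
      √(((25 : ℝ) + 33 - 2) / (25 * 33)) ≤ 651339 / 2500000 :=
    Real.sqrt_mem_Icc_of_sq (by norm_num) (by norm_num) (by norm_num)
  have h1 : (2560381 / 10000000 : ℝ) ≤ √(((25 : ℝ) + 36 - 2) / (25 * 36)) ∧
      √(((25 : ℝ) + 36 - 2) / (25 * 36)) ≤ 1280191 / 5000000 :=
    Real.sqrt_mem_Icc_of_sq (by norm_num) (by norm_num) (by norm_num)
  have h2 : (1194121 / 5000000 : ℝ) ≤ √(((25 : ℝ) + 54 - 2) / (25 * 54)) ∧
      √(((25 : ℝ) + 54 - 2) / (25 * 54)) ≤ 2388243 / 10000000 :=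
    Real.sqrt_mem_Icc_of_sq (by norm_num) (by norm_num) (by norm_num)
  have h3 : (2279211 / 10000000 : ℝ) ≤ √(((25 : ℝ) + 77 - 2) / (25 * 77)) ∧
      √(((25 : ℝ) + 77 - 2) / (25 * 77)) ≤ 569803 / 2500000 :=
    Real.sqrt_mem_Icc_of_sq (by norm_num) (by norm_num) (by norm_num)
  have h4 : (1092859 / 5000000 : ℝ) ≤ √(((28 : ℝ) + 77 - 2) / (28 * 77)) ∧
      √(((28 : ℝ) + 77 - 2) / (28 * 77)) ≤ 2185719 / 10000000 :=
    Real.sqrt_mem_Icc_of_sq (by norm_num) (by norm_num) (by norm_num)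
  have h5 : (2374811 / 10000000 : ℝ) ≤ √(((33 : ℝ) + 36 - 2) / (33 * 36)) ∧
      √(((33 : ℝ) + 36 - 2) / (33 * 36)) ≤ 593703 / 2500000 :=
    Real.sqrt_mem_Icc_of_sq (by norm_num) (by norm_num) (by norm_num)
  have h6 : (1092007 / 5000000 : ℝ) ≤ √(((33 : ℝ) + 54 - 2) / (33 * 54)) ∧
      √(((33 : ℝ) + 54 - 2) / (33 * 54)) ≤ 436803 / 2000000 :=
    Real.sqrt_mem_Icc_of_sq (by norm_num) (by norm_num) (by norm_num)
  have h7 : (1938689 / 10000000 : ℝ) ≤ √(((33 : ℝ) + 129 - 2) / (33 * 129)) ∧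
      √(((33 : ℝ) + 129 - 2) / (33 * 129)) ≤ 193869 / 1000000 :=
    Real.sqrt_mem_Icc_of_sq (by norm_num) (by norm_num) (by norm_num)
  have h8 : (2001081 / 10000000 : ℝ) ≤ √(((36 : ℝ) + 77 - 2) / (36 * 77)) ∧
      √(((36 : ℝ) + 77 - 2) / (36 * 77)) ≤ 1000541 / 5000000 :=
    Real.sqrt_mem_Icc_of_sq (by norm_num) (by norm_num) (by norm_num)
  have h9 : (936737 / 5000000 : ℝ) ≤ √(((36 : ℝ) + 129 - 2) / (36 * 129)) ∧
      √(((36 : ℝ) + 129 - 2) / (36 * 129)) ≤ 74939 / 400000 :=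
    Real.sqrt_mem_Icc_of_sq (by norm_num) (by norm_num) (by norm_num)
  have h10 : (433927 / 2500000 : ℝ) ≤ √(((44 : ℝ) + 129 - 2) / (44 * 129)) ∧
      √(((44 : ℝ) + 129 - 2) / (44 * 129)) ≤ 1735709 / 10000000 :=
    Real.sqrt_mem_Icc_of_sq (by norm_num) (by norm_num) (by norm_num)
  have h11 : (880689 / 5000000 : ℝ) ≤ √(((54 : ℝ) + 77 - 2) / (54 * 77)) ∧
      √(((54 : ℝ) + 77 - 2) / (54 * 77)) ≤ 1761379 / 10000000 :=
    Real.sqrt_mem_Icc_of_sq (by norm_num) (by norm_num) (by norm_num)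
  have h12 : (322387 / 2000000 : ℝ) ≤ √(((54 : ℝ) + 129 - 2) / (54 * 129)) ∧
      √(((54 : ℝ) + 129 - 2) / (54 * 129)) ≤ 50373 / 312500 :=
    Real.sqrt_mem_Icc_of_sq (by norm_num) (by norm_num) (by norm_num)
  have h13 : (198283 / 1250000 : ℝ) ≤ √(((77 : ℝ) + 80 - 2) / (77 * 80)) ∧
      √(((77 : ℝ) + 80 - 2) / (77 * 80)) ≤ 317253 / 2000000 :=
    Real.sqrt_mem_Icc_of_sq (by norm_num) (by norm_num) (by norm_num)
  have h14 : (716547 / 5000000 : ℝ) ≤ √(((77 : ℝ) + 129 - 2) / (77 * 129)) ∧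
      √(((77 : ℝ) + 129 - 2) / (77 * 129)) ≤ 286619 / 2000000 :=
    Real.sqrt_mem_Icc_of_sq (by norm_num) (by norm_num) (by norm_num)
  have h15 : (353061 / 2500000 : ℝ) ≤ √(((77 : ℝ) + 140 - 2) / (77 * 140)) ∧
      √(((77 : ℝ) + 140 - 2) / (77 * 140)) ≤ 282449 / 2000000 :=
    Real.sqrt_mem_Icc_of_sq (by norm_num) (by norm_num) (by norm_num)
  have h16 : (151987 / 1250000 : ℝ) ≤ √(((129 : ℝ) + 140 - 2) / (129 * 140)) ∧
      √(((129 : ℝ) + 140 - 2) / (129 * 140)) ≤ 1215897 / 10000000 :=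
    Real.sqrt_mem_Icc_of_sq (by norm_num) (by norm_num) (by norm_num)
  have h17 : (1185867 / 10000000 : ℝ) ≤ √(((129 : ℝ) + 156 - 2) / (129 * 156)) ∧
      √(((129 : ℝ) + 156 - 2) / (129 * 156)) ≤ 296467 / 2500000 :=
    Real.sqrt_mem_Icc_of_sq (by norm_num) (by norm_num) (by norm_num)
  rw [abs_le, abcConst]
  constructor <;> linarith only [
    h0.1, h0.2, h1.1, h1.2, h2.1, h2.2, h3.1, h3.2, h4.1, h4.2, h5.1, h5.2,
    h6.1, h6.2, h7.1, h7.2, h8.1, h8.2, h9.1, h9.2, h10.1, h10.2, h11.1, h11.2,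
    h12.1, h12.2, h13.1, h13.2, h14.1, h14.2, h15.1, h15.2, h16.1, h16.2, h17.1, h17.2]

theorem abs_gaConst_sub_le : |gaConst - 315.338| ≤ 0.0005 := by
  have h0 : (71807033 / 2500000 : ℝ) ≤ √((25 : ℝ) * 33) ∧
      √((25 : ℝ) * 33) ≤ 287228133 / 10000000 :=
    Real.sqrt_mem_Icc_of_sq (by norm_num) (by norm_num) (by norm_num)
  have h1 : (30 : ℝ) ≤ √((25 : ℝ) * 36) ∧
      √((25 : ℝ) * 36) ≤ 300000001 / 10000000 :=
    Real.sqrt_mem_Icc_of_sq (by norm_num) (by norm_num) (by norm_num)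
  have h2 : (367423461 / 10000000 : ℝ) ≤ √((25 : ℝ) * 54) ∧
      √((25 : ℝ) * 54) ≤ 183711731 / 5000000 :=
    Real.sqrt_mem_Icc_of_sq (by norm_num) (by norm_num) (by norm_num)
  have h3 : (438748219 / 10000000 : ℝ) ≤ √((25 : ℝ) * 77) ∧
      √((25 : ℝ) * 77) ≤ 21937411 / 500000 :=
    Real.sqrt_mem_Icc_of_sq (by norm_num) (by norm_num) (by norm_num)
  have h4 : (46432747 / 1000000 : ℝ) ≤ √((28 : ℝ) * 77) ∧
      √((28 : ℝ) * 77) ≤ 464327471 / 10000000 :=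
    Real.sqrt_mem_Icc_of_sq (by norm_num) (by norm_num) (by norm_num)
  have h5 : (172336879 / 5000000 : ℝ) ≤ √((33 : ℝ) * 36) ∧
      √((33 : ℝ) * 36) ≤ 344673759 / 10000000 :=
    Real.sqrt_mem_Icc_of_sq (by norm_num) (by norm_num) (by norm_num)
  have h6 : (211068709 / 5000000 : ℝ) ≤ √((33 : ℝ) * 54) ∧
      √((33 : ℝ) * 54) ≤ 422137419 / 10000000 :=
    Real.sqrt_mem_Icc_of_sq (by norm_num) (by norm_num) (by norm_num)
  have h7 : (130491379 / 2000000 : ℝ) ≤ √((33 : ℝ) * 129) ∧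
      √((33 : ℝ) * 129) ≤ 10194639 / 156250 :=
    Real.sqrt_mem_Icc_of_sq (by norm_num) (by norm_num) (by norm_num)
  have h8 : (526497863 / 10000000 : ℝ) ≤ √((36 : ℝ) * 77) ∧
      √((36 : ℝ) * 77) ≤ 65812233 / 1250000 :=
    Real.sqrt_mem_Icc_of_sq (by norm_num) (by norm_num) (by norm_num)
  have h9 : (681469001 / 10000000 : ℝ) ≤ √((36 : ℝ) * 129) ∧
      √((36 : ℝ) * 129) ≤ 340734501 / 5000000 :=
    Real.sqrt_mem_Icc_of_sq (by norm_num) (by norm_num) (by norm_num)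
  have h10 : (94174041 / 1250000 : ℝ) ≤ √((44 : ℝ) * 129) ∧
      √((44 : ℝ) * 129) ≤ 753392329 / 10000000 :=
    Real.sqrt_mem_Icc_of_sq (by norm_num) (by norm_num) (by norm_num)
  have h11 : (644825557 / 10000000 : ℝ) ≤ √((54 : ℝ) * 77) ∧
      √((54 : ℝ) * 77) ≤ 322412779 / 5000000 :=
    Real.sqrt_mem_Icc_of_sq (by norm_num) (by norm_num) (by norm_num)
  have h12 : (6520513 / 78125 : ℝ) ≤ √((54 : ℝ) * 129) ∧
      √((54 : ℝ) * 129) ≤ 166925133 / 2000000 :=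
    Real.sqrt_mem_Icc_of_sq (by norm_num) (by norm_num) (by norm_num)
  have h13 : (392428337 / 5000000 : ℝ) ≤ √((77 : ℝ) * 80) ∧
      √((77 : ℝ) * 80) ≤ 31394267 / 400000 :=
    Real.sqrt_mem_Icc_of_sq (by norm_num) (by norm_num) (by norm_num)
  have h14 : (996644369 / 10000000 : ℝ) ≤ √((77 : ℝ) * 129) ∧
      √((77 : ℝ) * 129) ≤ 99664437 / 1000000 :=
    Real.sqrt_mem_Icc_of_sq (by norm_num) (by norm_num) (by norm_num)
  have h15 : (259566947 / 2500000 : ℝ) ≤ √((77 : ℝ) * 140) ∧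
      √((77 : ℝ) * 140) ≤ 1038267789 / 10000000 :=
    Real.sqrt_mem_Icc_of_sq (by norm_num) (by norm_num) (by norm_num)
  have h16 : (671937497 / 5000000 : ℝ) ≤ √((129 : ℝ) * 140) ∧
      √((129 : ℝ) * 140) ≤ 268774999 / 2000000 :=
    Real.sqrt_mem_Icc_of_sq (by norm_num) (by norm_num) (by norm_num)
  have h17 : (28371817 / 200000 : ℝ) ≤ √((129 : ℝ) * 156) ∧
      √((129 : ℝ) * 156) ≤ 1418590851 / 10000000 :=
    Real.sqrt_mem_Icc_of_sq (by norm_num) (by norm_num) (by norm_num)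
  rw [abs_le, gaConst]
  constructor <;> linarith only [
    h0.1, h0.2, h1.1, h1.2, h2.1, h2.2, h3.1, h3.2, h4.1, h4.2, h5.1, h5.2,
    h6.1, h6.2, h7.1, h7.2, h8.1, h8.2, h9.1, h9.2, h10.1, h10.2, h11.1, h11.2,
    h12.1, h12.2, h13.1, h13.2, h14.1, h14.2, h15.1, h15.2, h16.1, h16.2, h17.1, h17.2]

theorem ABC4_HDN3 {r : ℕ} (hr : 5 ≤ r) : ABC4 (HDN3 r) = abcConst
        + 3 / 20 * √(79 / 2) * (-5 + (r : ℝ))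
        + 3 * √(53 / 70) * (-4 + (r : ℝ))
        + 3 / 5 * √(109 / 14) * (-4 + (r : ℝ))
        + √(114 / 5) * (-4 + (r : ℝ))
        + 3 / 35 * √(139 / 2) * (-4 + (r : ℝ))
        + 3 * √(14 / 65) * (-3 + (r : ℝ))
        + 12 * √(26 / 55) * (-3 + (r : ℝ))
        + 2 * √(174 / 35) * (-3 + (r : ℝ))
        + √(62 / 7) * (-3 + (r : ℝ))
        + √(78 / 11) * (-2 + (r : ℝ))
        + 9 / 11 * √(43 / 2) * (-2 + (r : ℝ)) ^ 2
        + 1 / 3 * √(35 / 2) * (-5 + 2 * (r : ℝ))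
        + 1 / 26 * √(155 / 2) * (24 - 17 * (r : ℝ) + 3 * (r : ℝ) ^ 2)
        + 3 * √(6 / 13) * (19 - 15 * (r : ℝ) + 3 * (r : ℝ) ^ 2) := by
  have h : ABC4 (HDN3 r) = _ := sum_edgeFinset_HDN3
    (g := fun a b => √(((a : ℝ) + (b : ℝ) - 2) / ((a : ℝ) * (b : ℝ))))
    (fun a b => by rw [add_comm (a : ℝ), mul_comm (a : ℝ)]) hr
  rw [h]
  simp only [hdn3Classes, List.map_cons, List.map_nil, List.sum_cons, List.sum_nil]
  push_cast
  -- Only the 14 classes whose size depends on `r` are simplified; the 18 classes of constant size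
  -- make up `abcConst`.
  rw [abcConst, show √(((28 : ℝ) + 36 - 2) / (28 * 36)) = 1 / 12 * √(62 / 7) from
      Real.sqrt_eq_mul_sqrt (by norm_num) (by norm_num),
    show √(((28 : ℝ) + 80 - 2) / (28 * 80)) = 1 / 4 * √(53 / 70) from
      Real.sqrt_eq_mul_sqrt (by norm_num) (by norm_num),
    show √(((36 : ℝ) + 36 - 2) / (36 * 36)) = 1 / 18 * √(35 / 2) from
      Real.sqrt_eq_mul_sqrt (by norm_num) (by norm_num),
    show √(((36 : ℝ) + 44 - 2) / (36 * 44)) = 1 / 12 * √(78 / 11) from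
      Real.sqrt_eq_mul_sqrt (by norm_num) (by norm_num),
    show √(((36 : ℝ) + 80 - 2) / (36 * 80)) = 1 / 24 * √(114 / 5) from
      Real.sqrt_eq_mul_sqrt (by norm_num) (by norm_num),
    show √(((36 : ℝ) + 140 - 2) / (36 * 140)) = 1 / 12 * √(174 / 35) from
      Real.sqrt_eq_mul_sqrt (by norm_num) (by norm_num),
    show √(((44 : ℝ) + 44 - 2) / (44 * 44)) = 1 / 22 * √(43 / 2) from
      Real.sqrt_eq_mul_sqrt (by norm_num) (by norm_num),
    show √(((44 : ℝ) + 140 - 2) / (44 * 140)) = 1 / 4 * √(26 / 55) from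
      Real.sqrt_eq_mul_sqrt (by norm_num) (by norm_num),
    show √(((44 : ℝ) + 156 - 2) / (44 * 156)) = 1 / 4 * √(6 / 13) from
      Real.sqrt_eq_mul_sqrt (by norm_num) (by norm_num),
    show √(((80 : ℝ) + 80 - 2) / (80 * 80)) = 1 / 40 * √(79 / 2) from
      Real.sqrt_eq_mul_sqrt (by norm_num) (by norm_num),
    show √(((80 : ℝ) + 140 - 2) / (80 * 140)) = 1 / 20 * √(109 / 14) from
      Real.sqrt_eq_mul_sqrt (by norm_num) (by norm_num),
    show √(((140 : ℝ) + 140 - 2) / (140 * 140)) = 1 / 70 * √(139 / 2) from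
      Real.sqrt_eq_mul_sqrt (by norm_num) (by norm_num),
    show √(((140 : ℝ) + 156 - 2) / (140 * 156)) = 1 / 4 * √(14 / 65) from
      Real.sqrt_eq_mul_sqrt (by norm_num) (by norm_num),
    show √(((156 : ℝ) + 156 - 2) / (156 * 156)) = 1 / 78 * √(155 / 2) from
      Real.sqrt_eq_mul_sqrt (by norm_num) (by norm_num)]
  ring

theorem GA5_HDN3 {r : ℕ} (hr : 5 ≤ r) : GA5 (HDN3 r) = gaConst
        + 288 / 29 * √5 * (-4 + (r : ℝ))
        + 48 / 11 * √7 * (-4 + (r : ℝ))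
        + 16 / 9 * √35 * (-4 + (r : ℝ))
        + 9 / 2 * √7 * (-3 + (r : ℝ))
        + 36 / 11 * √35 * (-3 + (r : ℝ))
        + 48 / 23 * √385 * (-3 + (r : ℝ))
        + 12 / 37 * √1365 * (-3 + (r : ℝ))
        + 18 / 5 * √11 * (-2 + (r : ℝ))
        - 99 * (r : ℝ) + 27 * (r : ℝ) ^ 2
        + 12 / 25 * √429 * (19 - 15 * (r : ℝ) + 3 * (r : ℝ) ^ 2) := by
  have h : GA5 (HDN3 r) = _ := sum_edgeFinset_HDN3
    (g := fun a b => 2 * √((a : ℝ) * (b : ℝ)) / ((a : ℝ) + (b : ℝ)))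
    (fun a b => by rw [add_comm (a : ℝ), mul_comm (a : ℝ)]) hr
  rw [h]
  simp only [hdn3Classes, List.map_cons, List.map_nil, List.sum_cons, List.sum_nil]
  push_cast
  rw [gaConst, show √((28 : ℝ) * 36) = 12 * √7 from
      Real.sqrt_eq_mul_sqrt (by norm_num) (by norm_num),
    show √((28 : ℝ) * 80) = 8 * √35 from
      Real.sqrt_eq_mul_sqrt (by norm_num) (by norm_num),
    -- An edge with equal sums contributes exactly 1. The five such classes have 27r² - 99r + 60
    -- edges in all, which explains the 60 in `gaConst`.
    show √((36 : ℝ) * 36) = 36 from Real.sqrt_mul_self (by norm_num),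
    show √((36 : ℝ) * 44) = 12 * √11 from
      Real.sqrt_eq_mul_sqrt (by norm_num) (by norm_num),
    show √((36 : ℝ) * 80) = 24 * √5 from
      Real.sqrt_eq_mul_sqrt (by norm_num) (by norm_num),
    show √((36 : ℝ) * 140) = 12 * √35 from
      Real.sqrt_eq_mul_sqrt (by norm_num) (by norm_num),
    show √((44 : ℝ) * 44) = 44 from Real.sqrt_mul_self (by norm_num),
    show √((44 : ℝ) * 140) = 4 * √385 from
      Real.sqrt_eq_mul_sqrt (by norm_num) (by norm_num),
    show √((44 : ℝ) * 156) = 4 * √429 from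
      Real.sqrt_eq_mul_sqrt (by norm_num) (by norm_num),
    show √((80 : ℝ) * 80) = 80 from Real.sqrt_mul_self (by norm_num),
    show √((80 : ℝ) * 140) = 40 * √7 from
      Real.sqrt_eq_mul_sqrt (by norm_num) (by norm_num),
    show √((140 : ℝ) * 140) = 140 from Real.sqrt_mul_self (by norm_num),
    show √((140 : ℝ) * 156) = 4 * √1365 from
      Real.sqrt_eq_mul_sqrt (by norm_num) (by norm_num),
    show √((156 : ℝ) * 156) = 156 from Real.sqrt_mul_self (by norm_num)]
  ring

theorem theorem4 :
    -- the two constants that are given in decimals, rounded to three places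
    ∃ cA cG : ℝ, |cA - 53.139| ≤ 0.0005 ∧ |cG - 315.338| ≤ 0.0005 ∧
    ∀ r : ℕ, 5 ≤ r →
      -- the partition of the edges into 32 classes
      (∀ c ∈ hdn3Classes r, ((edgeClass (HDN3 r) c.1.1 c.1.2).card : ℤ) = c.2) ∧
      (∀ e ∈ (HDN3 r).edgeFinset, ∃ c ∈ hdn3Classes r, e ∈ edgeClass (HDN3 r) c.1.1 c.1.2) ∧
      -- the fourth atom-bond connectivity index
      ABC4 (HDN3 r) = cA
        + 3 / 20 * √(79 / 2) * (-5 + (r : ℝ))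
        + 3 * √(53 / 70) * (-4 + (r : ℝ))
        + 3 / 5 * √(109 / 14) * (-4 + (r : ℝ))
        + √(114 / 5) * (-4 + (r : ℝ))
        + 3 / 35 * √(139 / 2) * (-4 + (r : ℝ))
        + 3 * √(14 / 65) * (-3 + (r : ℝ))
        + 12 * √(26 / 55) * (-3 + (r : ℝ))
        + 2 * √(174 / 35) * (-3 + (r : ℝ))
        + √(62 / 7) * (-3 + (r : ℝ))
        + √(78 / 11) * (-2 + (r : ℝ))
        + 9 / 11 * √(43 / 2) * (-2 + (r : ℝ)) ^ 2
        + 1 / 3 * √(35 / 2) * (-5 + 2 * (r : ℝ))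
        + 1 / 26 * √(155 / 2) * (24 - 17 * (r : ℝ) + 3 * (r : ℝ) ^ 2)
        + 3 * √(6 / 13) * (19 - 15 * (r : ℝ) + 3 * (r : ℝ) ^ 2) ∧
      -- the fifth geometric-arithmetic index
      GA5 (HDN3 r) = cG
        + 288 / 29 * √5 * (-4 + (r : ℝ))
        + 48 / 11 * √7 * (-4 + (r : ℝ))
        + 16 / 9 * √35 * (-4 + (r : ℝ))
        + 9 / 2 * √7 * (-3 + (r : ℝ))
        + 36 / 11 * √35 * (-3 + (r : ℝ))
        + 48 / 23 * √385 * (-3 + (r : ℝ))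
        + 12 / 37 * √1365 * (-3 + (r : ℝ))
        + 18 / 5 * √11 * (-2 + (r : ℝ))
        - 99 * (r : ℝ) + 27 * (r : ℝ) ^ 2
        + 12 / 25 * √429 * (19 - 15 * (r : ℝ) + 3 * (r : ℝ) ^ 2) := by
  exact ⟨abcConst, gaConst, abs_abcConst_sub_le, abs_gaConst_sub_le, fun r hr =>
    ⟨fun c hc => card_edgeClass_HDN3 hr hc, fun e he => exists_mem_edgeClass_HDN3 hr he,
      ABC4_HDN3 hr, GA5_HDN3 hr⟩⟩
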